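/- Let $C$ be an Abelian von Neumann algebra with spectrum $\Delta$ (its space of characters). A Banach $C$-bimodule $V$ is \emph{representable} if there are Hilbert spaces $\mathcal K,\mathcal L$ with $*$-representations $\pi:C\to B(\mathcal K)$, $\sigma:C\to B(\mathcal L)$ and an isometric linear map $J:V\to B(\mathcal L,\mathcal K)$ with $J(cv)=\pi(c)J(v)$ and $J(vc)=J(v)\sigma(c)$; it is \emph{normal representable} if $\pi$ and $\sigma$ can be chosen normal (weak* continuous), and \emph{central} if $cv=vc$ for all $c\in C$, $v\in V$. Let $X,Y$ be central normal representable Banach $C$-bimodules. Let $X\overset{\gamma}{\otimes}_C Y$ be the completion (after dividing out the zero space) of the algebraic tensor product $X\otimes_C Y$ in the projective seminorm $\gamma_C(w)=\inf\{\sum_j\|x_j\|\|y_j\| : w=\sum_{j=1}^n x_j\otimes_C y_j\}$; for Banach spaces, $\overset{\gamma}{\otimes}$ denotes the same construction over $\mathbb C$. Let $X\overset{\nu}{\otimes}_C Y$ be the completion of $X\otimes_C Y$ in $\nu_C(w)=\sup\|\phi(w)\|$, the supremum over all $C$-bilinear contractions $\phi$ from $X\times Y$ into normal representable Banach $C$-bimodules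 (that is, $\phi(cx,y)=c\phi(x,y)$, $\phi(xc,y)=\phi(x,cy)$, $\phi(x,yc)=\phi(x,y)c$ and $\|\phi(x,y)\|\le\|x\|\|y\|$). For $t\in\Delta$ let $X(t)=X/[(\ker t)X]$ be the quotient by the closed linear span of $(\ker t)X$, and $x(t)$ the class of $x$. For Banach spaces $(E_t)_{t\in\Delta}$ let $\mathrm{ess}\oplus_{t\in\Delta} E_t$ be the quotient of their $\ell_\infty$-direct sum by the zero space of the seminorm $(z_t)\mapsto\inf\{c : \{t:\|z_t\|>c\}\text{ is meager}\}$, with the induced norm. Then: (i) $X\overset{\nu}{\otimes}_C Y$ is the normal part of the representable $C$-bimodule $Z=X\overset{\gamma}{\otimes}_C Y$: it is a normal representable $C$-bimodule, there is a contractive $C$-bimodule map $\iota:Z\to X\overset{\nu}{\otimes}_C Y$ with $\iota(x\otimes_C y)=x\otimes_C y$, and for every normal representable Banach $C$-bimodule $V$ and every bounded $C$-bimodule map $T:Z\to V$ there is a unique bounded $C$-bimodule map $T':X\overset{\nu}{\otimes}_C Y\to V$ with $T'\iota=T$, and it satisfies $\|T'\|\le\|T\|$. Moreover, the canonical map $$X\overset{\nu}{\otimes}_C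 Y\to\mathrm{ess}\oplus_{t\in\Delta}\bigl(X(t)\overset{\gamma}{\otimes}Y(t)\bigr),\qquad x\otimes_C y\mapsto\bigl(x(t)\otimes y(t)\bigr)_{t\in\Delta},$$ is a well-defined linear isometry. (ii) For all $x_j\in X$, $y_j\in Y$, $\nu_C\bigl(\sum_{j=1}^n x_j\otimes_C y_j\bigr)=\sup\bigl\|\sum_{j=1}^n\theta(x_j,y_j)\bigr\|$, the supremum over all $C$-bilinear contractions $\theta:X\times Y\to C$. (iii) For all $x_j\in X$, $y_j\in Y$, $\nu_C\bigl(\sum_{j=1}^n x_j\otimes_C y_j\bigr)=\sup\bigl|\sum_{j=1}^n\theta(x_j,y_j)\bigr|$, the supremum over all $\mathbb C$-bilinear contractions $\theta:X\times Y\to\mathbb C$ that are $C$-balanced ($\theta(xc,y)=\theta(x,cy)$) and such that $c\mapsto\theta(x,cy)$ is weak* continuous on $C$ for all $x\in X$, $y\in Y$. -/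

import Mathlib

open scoped TensorProduct InnerProductSpace ENNReal Topology
open MulOpposite UniformSpace WeakDual

universe u

noncomputable section

namespace CentralModule

/-! ### Von Neumann algebras and their weak* topology -/

section VonNeumann

/-- The ultraweak (`σ`-weak, weak*) topology of `B(H)`: the coarsest topology for which all the
functionals `T ↦ ∑ₙ ⟪ηₙ, T ξₙ⟫`, with `(ξₙ)` and `(ηₙ)` square-summable, are continuous. -/
@[reducible]
def ultraweak (H : Type u) [NormedAddCommGroup H] [InnerProductSpace ℂ H] :
    TopologicalSpace (H →L[ℂ] H) :=
  ⨅ p : lp (fun _ : ℕ => H) 2 × lp (fun _ : ℕ => H) 2,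
    TopologicalSpace.induced (fun T : H →L[ℂ] H => ∑' n, ⟪p.2 n, T (p.1 n)⟫_ℂ) inferInstance

variable {C : Type u} [CommCStarAlgebra C]
variable {H : Type u} [NormedAddCommGroup H] [InnerProductSpace ℂ H] [CompleteSpace H]

/-- `C` is a von Neumann algebra acting on `H` through the embedding `ρ`. -/
def IsVonNeumann (ρ : C →⋆ₐ[ℂ] (H →L[ℂ] H)) : Prop :=
  Function.Injective ρ ∧ ∃ S : VonNeumannAlgebra H, (S : Set (H →L[ℂ] H)) = Set.range ρ

/-- The weak* topology of the von Neumann algebra `C`, acting on `H` through `ρ`. -/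
@[reducible]
def weakStar (ρ : C →⋆ₐ[ℂ] (H →L[ℂ] H)) : TopologicalSpace C :=
  TopologicalSpace.induced ρ (ultraweak H)

/-- A representation `π` of the von Neumann algebra `C` is normal if it is weak* continuous. -/
def IsNormalRep (ρ : C →⋆ₐ[ℂ] (H →L[ℂ] H)) {K : Type u} [NormedAddCommGroup K]
    [InnerProductSpace ℂ K] [CompleteSpace K] (π : C →⋆ₐ[ℂ] (K →L[ℂ] K)) : Prop :=
  Continuous[weakStar ρ, ultraweak K] π

end VonNeumann

/-! ### Representable bimodules

A `C`-bimodule is a module over `C` (left action) and over `Cᵐᵒᵖ` (right action); it is central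
if `IsCentralScalar` holds. -/

section Bimodule

variable (C : Type u) [CommCStarAlgebra C]
variable {H : Type u} [NormedAddCommGroup H] [InnerProductSpace ℂ H] [CompleteSpace H]

/-- `V` is a representable `C`-bimodule: it embeds isometrically in some `B(L, K)`, where `K` and
`L` are Hilbert modules over `C`. -/
def IsRepresentable (V : Type u) [NormedAddCommGroup V] [NormedSpace ℂ V] [Module C V]
    [Module Cᵐᵒᵖ V] : Prop :=
  ∃ (K : Type u) (_ : NormedAddCommGroup K) (_ : InnerProductSpace ℂ K) (_ : CompleteSpace K)
    (L : Type u) (_ : NormedAddCommGroup L) (_ : InnerProductSpace ℂ L) (_ : CompleteSpace L)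
    (π : C →⋆ₐ[ℂ] (K →L[ℂ] K)) (σ : C →⋆ₐ[ℂ] (L →L[ℂ] L)) (J : V →ₗᵢ[ℂ] (L →L[ℂ] K)),
    (∀ (c : C) (v : V), J (c • v) = (π c).comp (J v)) ∧
    (∀ (c : C) (v : V), J (op c • v) = (J v).comp (σ c))

variable {C}

/-- `V` is a normal representable `C`-bimodule: as `IsRepresentable`, with both representations
of the von Neumann algebra `C` normal. -/
def IsNormalRepresentable (ρ : C →⋆ₐ[ℂ] (H →L[ℂ] H)) (V : Type u) [NormedAddCommGroup V]
    [NormedSpace ℂ V] [Module C V] [Module Cᵐᵒᵖ V] : Prop :=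
  ∃ (K : Type u) (_ : NormedAddCommGroup K) (_ : InnerProductSpace ℂ K) (_ : CompleteSpace K)
    (L : Type u) (_ : NormedAddCommGroup L) (_ : InnerProductSpace ℂ L) (_ : CompleteSpace L)
    (π : C →⋆ₐ[ℂ] (K →L[ℂ] K)) (σ : C →⋆ₐ[ℂ] (L →L[ℂ] L)) (J : V →ₗᵢ[ℂ] (L →L[ℂ] K)),
    IsNormalRep ρ π ∧ IsNormalRep ρ σ ∧
    (∀ (c : C) (v : V), J (c • v) = (π c).comp (J v)) ∧
    (∀ (c : C) (v : V), J (op c • v) = (J v).comp (σ c))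

variable (C)

/-- `C`-bimodule homomorphisms. -/
def IsBimoduleMap {V W : Type u} [SMul C V] [SMul Cᵐᵒᵖ V] [SMul C W] [SMul Cᵐᵒᵖ W]
    (f : V → W) : Prop :=
  ∀ (c : C) (v : V), f (c • v) = c • f v ∧ f (op c • v) = op c • f v

variable {C}

/-- `N`, together with `ι : Z → N`, is the normal part of the representable Banach
`C`-bimodule `Z`. -/
structure IsNormalPart (ρ : C →⋆ₐ[ℂ] (H →L[ℂ] H))
    {Z : Type u} [NormedAddCommGroup Z] [NormedSpace ℂ Z] [Module C Z] [Module Cᵐᵒᵖ Z]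
    {N : Type u} [NormedAddCommGroup N] [NormedSpace ℂ N] [Module C N] [Module Cᵐᵒᵖ N]
    (ι : Z →L[ℂ] N) : Prop where
  complete_left : CompleteSpace Z
  representable : IsRepresentable C Z
  complete : CompleteSpace N
  normal : IsNormalRepresentable ρ N
  contractive : ‖ι‖ ≤ 1
  bimoduleMap : IsBimoduleMap C ι
  universal : ∀ (V : Type u) [NormedAddCommGroup V] [NormedSpace ℂ V] [CompleteSpace V]
    [Module C V] [Module Cᵐᵒᵖ V], IsNormalRepresentable ρ V →
    ∀ T : Z →L[ℂ] V, IsBimoduleMap C T →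
      ∃ T' : N →L[ℂ] V, IsBimoduleMap C T' ∧ T'.comp ι = T ∧ ‖T'‖ ≤ ‖T‖ ∧
        ∀ S : N →L[ℂ] V, IsBimoduleMap C S → S.comp ι = T → S = T'

end Bimodule

/-! ### The projective tensor product -/

section Gamma

variable (R : Type*) [CommRing R] (X Y : Type u)
variable [NormedAddCommGroup X] [Module R X] [NormedAddCommGroup Y] [Module R Y]

/-- The projective tensor seminorm on `X ⊗[R] Y`. -/
def gammaNorm {R : Type*} {X Y : Type u} [CommRing R] [NormedAddCommGroup X] [Module R X] [NormedAddCommGroup Y]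
    [Module R Y] (w : X ⊗[R] Y) : ℝ :=
  sInf {r | ∃ (n : ℕ) (x : Fin n → X) (y : Fin n → Y),
    w = ∑ j, x j ⊗ₜ[R] y j ∧ r = ∑ j, ‖x j‖ * ‖y j‖}

variable {R X Y}

theorem exists_rep (w : X ⊗[R] Y) :
    ∃ (n : ℕ) (x : Fin n → X) (y : Fin n → Y), w = ∑ j, x j ⊗ₜ[R] y j := by
  induction w with
  | zero => exact ⟨0, Fin.elim0, Fin.elim0, by simp⟩
  | tmul x y => exact ⟨1, fun _ => x, fun _ => y, by simp⟩
  | add a b ha hb =>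
    obtain ⟨n, x, y, rfl⟩ := ha
    obtain ⟨m, x', y', rfl⟩ := hb
    exact ⟨n + m, Fin.append x x', Fin.append y y', by simp [Fin.sum_univ_add]⟩

theorem gammaNorm_le {n : ℕ} (x : Fin n → X) (y : Fin n → Y) :
    gammaNorm (∑ j, x j ⊗ₜ[R] y j) ≤ ∑ j, ‖x j‖ * ‖y j‖ := by
  refine csInf_le ⟨0, ?_⟩ ⟨n, x, y, rfl, rfl⟩
  rintro r ⟨n, x, y, -, rfl⟩
  positivity

theorem le_gammaNorm {w : X ⊗[R] Y} {a : ℝ}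
    (h : ∀ (n : ℕ) (x : Fin n → X) (y : Fin n → Y), w = ∑ j, x j ⊗ₜ[R] y j →
      a ≤ ∑ j, ‖x j‖ * ‖y j‖) : a ≤ gammaNorm w := by
  obtain ⟨n, x, y, hw⟩ := exists_rep w
  refine le_csInf ⟨_, n, x, y, hw, rfl⟩ ?_
  rintro r ⟨n, x, y, hw, rfl⟩
  exact h n x y hw

theorem gammaNorm_nonneg (w : X ⊗[R] Y) : 0 ≤ gammaNorm w :=
  le_gammaNorm fun _ _ _ _ => by positivity

theorem gammaNorm_zero : gammaNorm (0 : X ⊗[R] Y) = 0 := by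
  refine le_antisymm ?_ (gammaNorm_nonneg _)
  simpa using gammaNorm_le (R := R) (Fin.elim0 : Fin 0 → X) (Fin.elim0 : Fin 0 → Y)

theorem gammaNorm_add_le (v w : X ⊗[R] Y) : gammaNorm (v + w) ≤ gammaNorm v + gammaNorm w := by
  rw [← sub_le_iff_le_add]
  refine le_gammaNorm fun n x y hv => ?_
  rw [sub_le_iff_le_add, ← sub_le_iff_le_add']
  refine le_gammaNorm fun m x' y' hw => ?_
  rw [sub_le_iff_le_add']
  have := gammaNorm_le (R := R) (Fin.append x x') (Fin.append y y')
  simpa [Fin.sum_univ_add, ← hv, ← hw] using this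

theorem gammaNorm_neg (w : X ⊗[R] Y) : gammaNorm (-w) = gammaNorm w := by
  have key : ∀ w : X ⊗[R] Y, gammaNorm (-w) ≤ gammaNorm w := fun w => by
    refine le_gammaNorm fun n x y hw => ?_
    have := gammaNorm_le (R := R) (fun j => -x j) y
    simpa [TensorProduct.neg_tmul, ← hw] using this
  refine le_antisymm (key w) ?_
  simpa using key (-w)

theorem gammaNorm_smul_le {R' : Type*} [SeminormedRing R'] [Module R' X] [SMulCommClass R R' X]
    [IsBoundedSMul R' X] (c : R') (w : X ⊗[R] Y) : gammaNorm (c • w) ≤ ‖c‖ * gammaNorm w := by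
  have h : ∀ (n : ℕ) (x : Fin n → X) (y : Fin n → Y), w = ∑ j, x j ⊗ₜ[R] y j →
      gammaNorm (c • w) ≤ ‖c‖ * ∑ j, ‖x j‖ * ‖y j‖ := by
    intro n x y hw
    have h1 := gammaNorm_le (R := R) (fun j => c • x j) y
    have h2 : c • w = ∑ j, (c • x j) ⊗ₜ[R] y j := by
      simp [hw, Finset.smul_sum, TensorProduct.smul_tmul']
    rw [h2, Finset.mul_sum]
    refine h1.trans (Finset.sum_le_sum fun j _ => ?_)
    rw [← mul_assoc]
    exact mul_le_mul_of_nonneg_right (norm_smul_le _ _) (norm_nonneg _)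
  rcases (norm_nonneg c).eq_or_lt with hc | hc
  · obtain ⟨n, x, y, hw⟩ := exists_rep w
    simpa [← hc] using h n x y hw
  · rw [← div_le_iff₀' hc]
    refine le_gammaNorm fun n x y hw => ?_
    rw [div_le_iff₀' hc]
    exact h n x y hw

variable (R X Y)

/-- The algebraic tensor product over `R`, equipped with the projective seminorm. -/
def GammaPre : Type u := X ⊗[R] Y

namespace GammaPre

instance : AddCommGroup (GammaPre R X Y) := inferInstanceAs (AddCommGroup (X ⊗[R] Y))

instance {R' : Type*} [Semiring R'] [Module R' X] [SMulCommClass R R' X] :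
    Module R' (GammaPre R X Y) := inferInstanceAs (Module R' (X ⊗[R] Y))

instance {R' : Type*} [Semiring R'] [Module R' X] [SMulCommClass R R' X] [Module R'ᵐᵒᵖ X]
    [IsCentralScalar R' X] : IsCentralScalar R' (GammaPre R X Y) :=
  inferInstanceAs (IsCentralScalar R' (X ⊗[R] Y))

instance : SeminormedAddCommGroup (GammaPre R X Y) :=
  AddGroupSeminorm.toSeminormedAddCommGroup
    { toFun := fun w : X ⊗[R] Y => gammaNorm w
      map_zero' := gammaNorm_zero
      add_le' := gammaNorm_add_le
      neg' := gammaNorm_neg }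

instance {R' : Type*} [SeminormedRing R'] [Module R' X] [SMulCommClass R R' X]
    [IsBoundedSMul R' X] : IsBoundedSMul R' (GammaPre R X Y) :=
  IsBoundedSMul.of_norm_smul_le fun c w => gammaNorm_smul_le (R := R) (X := X) (Y := Y) c w

instance [NormedSpace ℂ X] [SMulCommClass R ℂ X] : NormedSpace ℂ (GammaPre R X Y) where
  norm_smul_le := norm_smul_le

end GammaPre

/-- The projective tensor product of Banach `R`-modules: the (Hausdorff) completion of
`X ⊗[R] Y` for the projective seminorm. For `R = ℂ` it is the projective tensor product of
Banach spaces. -/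
abbrev Gamma : Type u := Completion (GammaPre R X Y)

variable {X Y}

/-- The elementary tensor `x ⊗ y` in the projective tensor product. -/
def Gamma.tmul (x : X) (y : Y) : Gamma R X Y :=
  ((show GammaPre R X Y from x ⊗ₜ[R] y : GammaPre R X Y) : Completion (GammaPre R X Y))

theorem Gamma.norm_tmul_le (x : X) (y : Y) : ‖Gamma.tmul R x y‖ ≤ ‖x‖ * ‖y‖ := by
  unfold Gamma.tmul
  rw [Completion.norm_coe]
  have := gammaNorm_le (R := R) (fun _ : Fin 1 => x) (fun _ => y)
  simp only [Finset.univ_unique, Finset.sum_singleton] at this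
  exact this

end Gamma

/-! ### The normal projective tensor product -/

section Nu

variable {C : Type u} [CommCStarAlgebra C]
variable {H : Type u} [NormedAddCommGroup H] [InnerProductSpace ℂ H] [CompleteSpace H]
variable (ρ : C →⋆ₐ[ℂ] (H →L[ℂ] H))
variable {X Y : Type u}
variable [NormedAddCommGroup X] [NormedSpace ℂ X] [Module C X] [IsScalarTower ℂ C X]
  [Module Cᵐᵒᵖ X]
variable [NormedAddCommGroup Y] [NormedSpace ℂ Y] [Module C Y] [IsScalarTower ℂ C Y]
  [Module Cᵐᵒᵖ Y]

/-- The values `‖φ(w)‖`, where `φ` runs over all `C`-bilinear contractions from `X × Y` into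
normal representable Banach `C`-bimodules. -/
def nuSet (w : X ⊗[C] Y) : Set ℝ :=
  {r | ∃ (V : Type u) (_ : NormedAddCommGroup V) (_ : NormedSpace ℂ V) (_ : CompleteSpace V)
    (_ : Module C V) (_ : Module Cᵐᵒᵖ V) (φ : X →ₗ[C] Y →ₗ[C] V),
    IsNormalRepresentable ρ V ∧ (∀ (c : C) (x : X) (y : Y), φ x (op c • y) = op c • φ x y) ∧
    (∀ x y, ‖φ x y‖ ≤ ‖x‖ * ‖y‖) ∧ r = ‖TensorProduct.lift φ w‖}

/-- The norm `ν_C` on `X ⊗[C] Y`. -/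
def nuNorm (w : X ⊗[C] Y) : ℝ := sSup (nuSet ρ w)

theorem nuSet_le {w : X ⊗[C] Y} {r : ℝ} (hr : r ∈ nuSet ρ w) : r ≤ gammaNorm w := by
  obtain ⟨V, _, _, _, _, _, φ, -, -, hφ, rfl⟩ := hr
  refine le_gammaNorm fun n x y hw => ?_
  rw [hw, map_sum]
  refine (norm_sum_le _ _).trans (Finset.sum_le_sum fun j _ => ?_)
  simpa using hφ (x j) (y j)

theorem nuSet_bddAbove (w : X ⊗[C] Y) : BddAbove (nuSet ρ w) :=
  ⟨gammaNorm w, fun _ => nuSet_le ρ⟩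

theorem nuNorm_nonneg (w : X ⊗[C] Y) : 0 ≤ nuNorm ρ w := by
  refine Real.sSup_nonneg ?_
  rintro r ⟨V, _, _, _, _, _, φ, -, -, -, rfl⟩
  exact norm_nonneg _

theorem nuNorm_zero : nuNorm ρ (0 : X ⊗[C] Y) = 0 := by
  refine le_antisymm (Real.sSup_le ?_ le_rfl) (nuNorm_nonneg ρ _)
  rintro r ⟨V, _, _, _, _, _, φ, -, -, -, rfl⟩
  simp

theorem nuNorm_add_le (v w : X ⊗[C] Y) : nuNorm ρ (v + w) ≤ nuNorm ρ v + nuNorm ρ w := by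
  refine Real.sSup_le ?_ (add_nonneg (nuNorm_nonneg ρ _) (nuNorm_nonneg ρ _))
  rintro r ⟨V, i1, i2, i3, i4, i5, φ, h1, h2, h3, rfl⟩
  rw [map_add]
  exact (norm_add_le _ _).trans (add_le_add
    (le_csSup (nuSet_bddAbove ρ v) ⟨V, i1, i2, i3, i4, i5, φ, h1, h2, h3, rfl⟩)
    (le_csSup (nuSet_bddAbove ρ w) ⟨V, i1, i2, i3, i4, i5, φ, h1, h2, h3, rfl⟩))

theorem nuNorm_neg (w : X ⊗[C] Y) : nuNorm ρ (-w) = nuNorm ρ w := by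
  unfold nuNorm nuSet
  simp only [map_neg, norm_neg]

theorem nuNorm_smul_le (c : C) (w : X ⊗[C] Y) : nuNorm ρ (c • w) ≤ ‖c‖ * nuNorm ρ w := by
  refine Real.sSup_le ?_ (mul_nonneg (norm_nonneg _) (nuNorm_nonneg ρ _))
  rintro r ⟨V, i1, i2, i3, i4, i5, φ, h1, h2, h3, rfl⟩
  have hle := le_csSup (nuSet_bddAbove ρ w) ⟨V, i1, i2, i3, i4, i5, φ, h1, h2, h3, rfl⟩
  obtain ⟨K, _, _, _, L, _, _, _, π, σ, J, -, -, hl, -⟩ := h1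
  rw [map_smul, ← J.norm_map, hl]
  calc _ ≤ ‖π c‖ * ‖J (TensorProduct.lift φ w)‖ := ContinuousLinearMap.opNorm_comp_le _ _
    _ ≤ ‖c‖ * ‖TensorProduct.lift φ w‖ := by
      rw [J.norm_map]
      exact mul_le_mul_of_nonneg_right (NonUnitalStarAlgHom.norm_apply_le π c) (norm_nonneg _)
    _ ≤ _ := mul_le_mul_of_nonneg_left hle (norm_nonneg _)

variable (X Y)

/-- The algebraic tensor product over `C`, equipped with `ν_C`. -/
def NuPre (_ : C →⋆ₐ[ℂ] (H →L[ℂ] H)) (X Y : Type u) [NormedAddCommGroup X] [Module C X]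
    [NormedAddCommGroup Y] [Module C Y] : Type u := X ⊗[C] Y

namespace NuPre

instance : AddCommGroup (NuPre ρ X Y) := inferInstanceAs (AddCommGroup (X ⊗[C] Y))

instance {R' : Type*} [Semiring R'] [Module R' X] [SMulCommClass C R' X] :
    Module R' (NuPre ρ X Y) := inferInstanceAs (Module R' (X ⊗[C] Y))

instance [IsCentralScalar C X] : IsCentralScalar C (NuPre ρ X Y) :=
  inferInstanceAs (IsCentralScalar C (X ⊗[C] Y))

instance : IsScalarTower ℂ C (NuPre ρ X Y) :=
  inferInstanceAs (IsScalarTower ℂ C (X ⊗[C] Y))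

instance : SeminormedAddCommGroup (NuPre ρ X Y) :=
  AddGroupSeminorm.toSeminormedAddCommGroup
    { toFun := fun w : X ⊗[C] Y => nuNorm ρ w
      map_zero' := nuNorm_zero ρ
      add_le' := nuNorm_add_le ρ
      neg' := nuNorm_neg ρ }

instance : IsBoundedSMul C (NuPre ρ X Y) :=
  IsBoundedSMul.of_norm_smul_le fun c w => nuNorm_smul_le (X := X) (Y := Y) ρ c w

instance : NormedSpace ℂ (NuPre ρ X Y) where
  norm_smul_le z w := by
    rcases subsingleton_or_nontrivial C with hC | hC
    · have : w = 0 := by rw [← one_smul C w, Subsingleton.elim (1 : C) 0, zero_smul]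
      simp [this]
    · rw [← algebraMap_smul C z w]
      refine (norm_smul_le _ _).trans ?_
      rw [norm_algebraMap']

end NuPre

/-- The normal projective tensor product: the completion of `X ⊗[C] Y` for `ν_C`. -/
abbrev Nu : Type u := Completion (NuPre ρ X Y)

variable {X Y}

/-- The elementary tensor `x ⊗ y` in the normal projective tensor product. -/
def Nu.tmul (x : X) (y : Y) : Nu ρ X Y :=
  ((show NuPre ρ X Y from x ⊗ₜ[C] y : NuPre ρ X Y) : Completion (NuPre ρ X Y))

end Nu

/-! ### Fibres over the spectrum -/

section Fiber

variable {C : Type u} [CommCStarAlgebra C] (t : characterSpace ℂ C)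
variable (X : Type u) [NormedAddCommGroup X] [NormedSpace ℂ X] [Module C X]

/-- The closed subspace `[C_t X]` of `X`, where `C_t` is the kernel of the character `t`. -/
def fiberKer : Submodule ℂ X :=
  (Submodule.span ℂ {z : X | ∃ (c : C) (x : X), t c = 0 ∧ z = c • x}).topologicalClosure

instance : IsClosed (fiberKer t X : Set X) := Submodule.isClosed_topologicalClosure _

/-- The fibre `X(t) = X / [C_t X]`, with the quotient norm. -/
abbrev Fiber : Type u := X ⧸ fiberKer t X

variable {X}

/-- The class `x(t)` of `x` in `X(t)`. -/
def Fiber.mk (x : X) : Fiber t X := (fiberKer t X).mkQ x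

theorem Fiber.norm_mk_le (x : X) : ‖Fiber.mk t x‖ ≤ ‖x‖ :=
  Submodule.Quotient.norm_mk_le (fiberKer t X) x

end Fiber

/-! ### Essential direct sums -/

section EssSum

variable {Δ : Type u} [TopologicalSpace Δ]

/-- The essential supremum of a function on `Δ` with respect to meagre sets. -/
def essup (f : Δ → ℝ) : ℝ := sInf {c : ℝ | IsMeagre {t | c < f t}}

variable [BaireSpace Δ] (E : Δ → Type u) [∀ t, NormedAddCommGroup (E t)]

theorem essup_lower {f : Δ → ℝ} [Nonempty Δ] (hf : ∀ t, 0 ≤ f t) {c : ℝ}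
    (hc : IsMeagre {t | c < f t}) : 0 ≤ c := by
  by_contra! h
  have : {t | c < f t} = Set.univ := Set.eq_univ_of_forall fun t => h.trans_le (hf t)
  rw [this] at hc
  have hd := dense_of_mem_residual hc
  rw [Set.compl_univ] at hd
  exact Set.not_nonempty_empty hd.nonempty

theorem essup_of_isEmpty [IsEmpty Δ] (f : Δ → ℝ) : essup f = 0 := by
  have : {c : ℝ | IsMeagre {t | c < f t}} = Set.univ :=
    Set.eq_univ_of_forall fun c => by
      have : {t | c < f t} = ∅ := Set.eq_empty_of_isEmpty _
      simp [this, IsMeagre.empty]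
  rw [essup, this, Real.sInf_univ]

theorem essup_zero : essup (fun _ : Δ => (0 : ℝ)) = 0 := by
  rcases isEmpty_or_nonempty Δ with h | h
  · exact essup_of_isEmpty _
  · refine le_antisymm (csInf_le ⟨0, fun c hc => essup_lower (fun _ => le_rfl) hc⟩ ?_)
      (Real.sInf_nonneg fun c hc => essup_lower (fun _ => le_rfl) hc)
    simp [IsMeagre.empty]

theorem essup_norm_add_le (x y : lp E ∞) :
    essup (fun t => ‖(x + y) t‖) ≤ essup (fun t => ‖x t‖) + essup (fun t => ‖y t‖) := by
  rcases isEmpty_or_nonempty Δ with h | h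
  · simp [essup_of_isEmpty]
  have ne : ∀ z : lp E ∞, {c : ℝ | IsMeagre {t | c < ‖z t‖}}.Nonempty := fun z => by
    refine ⟨‖z‖, ?_⟩
    have : {t | ‖z‖ < ‖z t‖} = ∅ :=
      Set.eq_empty_of_forall_notMem fun t ht =>
        absurd (lp.norm_apply_le_norm ENNReal.top_ne_zero z t) (not_le.2 ht)
    simp [this, IsMeagre.empty]
  have bd : ∀ z : lp E ∞, BddBelow {c : ℝ | IsMeagre {t | c < ‖z t‖}} := fun z =>
    ⟨0, fun c hc => essup_lower (fun t => norm_nonneg _) hc⟩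
  rw [← sub_le_iff_le_add]
  refine le_csInf (ne x) fun a ha => ?_
  rw [sub_le_iff_le_add, ← sub_le_iff_le_add']
  refine le_csInf (ne y) fun b hb => ?_
  rw [sub_le_iff_le_add']
  refine csInf_le (bd _) ((IsMeagre.union ha hb).mono fun t ht => ?_)
  by_contra hn
  simp only [Set.mem_union, Set.mem_ofPred_eq, not_or, not_lt] at hn ht
  have := norm_add_le (x t) (y t)
  have h2 : (x + y) t = x t + y t := rfl
  rw [h2] at ht
  linarith [hn.1, hn.2]

/-- The `ℓ^∞`-direct sum of the spaces `E t`, with the seminorm `x ↦ essup ‖x t‖`. -/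
def EssPre : Type u := lp E ∞

namespace EssPre

instance : AddCommGroup (EssPre E) := inferInstanceAs (AddCommGroup (lp E ∞))

instance [∀ t, NormedSpace ℂ (E t)] : Module ℂ (EssPre E) := inferInstanceAs (Module ℂ (lp E ∞))

instance : SeminormedAddCommGroup (EssPre E) :=
  AddGroupSeminorm.toSeminormedAddCommGroup
    { toFun := fun x : lp E ∞ => essup fun t => ‖x t‖
      map_zero' := by
        have : (fun t => ‖(0 : lp E ∞) t‖) = fun _ => (0 : ℝ) := funext fun t => norm_zero
        exact (congrArg essup this).trans essup_zero
      add_le' := essup_norm_add_le E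
      neg' := fun x : lp E ∞ => congrArg essup (funext fun t => norm_neg (x t)) }

instance [∀ t, NormedSpace ℂ (E t)] : NormedSpace ℂ (EssPre E) where
  norm_smul_le z x := by
    rcases eq_or_ne z 0 with rfl | hz
    · simp
    change essup (fun t => ‖z • (show lp E ∞ from x) t‖) ≤
      ‖z‖ * essup (fun t => ‖(show lp E ∞ from x) t‖)
    have hz' : 0 < ‖z‖ := norm_pos_iff.2 hz
    rw [← div_le_iff₀' hz']
    rcases isEmpty_or_nonempty Δ with h | h
    · simp [essup_of_isEmpty]
    refine le_csInf ⟨‖(show lp E ∞ from x)‖, ?_⟩ fun a ha => ?_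
    · have : {t | ‖(show lp E ∞ from x)‖ < ‖(show lp E ∞ from x) t‖} = ∅ :=
        Set.eq_empty_of_forall_notMem fun t ht =>
          absurd (lp.norm_apply_le_norm ENNReal.top_ne_zero (show lp E ∞ from x) t) (not_le.2 ht)
      rw [Set.mem_ofPred_eq, this]
      exact IsMeagre.empty
    · rw [div_le_iff₀' hz']
      refine csInf_le ⟨0, fun c hc => essup_lower (fun t => norm_nonneg _) hc⟩ (ha.mono ?_)
      intro t ht
      simp only [Set.mem_ofPred_eq, norm_smul] at ht ⊢
      exact lt_of_mul_lt_mul_left ht hz'.le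

end EssPre

/-- The essential direct sum of the Banach spaces `E t`: the quotient of their `ℓ^∞`-direct sum
by the zero space of the seminorm `x ↦ essup ‖x t‖`. -/
abbrev EssSum : Type u := SeparationQuotient (EssPre E)

variable {E}

/-- The quotient map from the `ℓ^∞`-direct sum to the essential direct sum. -/
def EssSum.mk (x : lp E ∞) : EssSum E := SeparationQuotient.mk (show EssPre E from x)

end EssSum

/-! ### The canonical decomposition of the tensor product -/

section Canonical

variable {C : Type u} [CommCStarAlgebra C]
variable {X Y : Type u}
variable [NormedAddCommGroup X] [NormedSpace ℂ X] [Module C X]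
variable [NormedAddCommGroup Y] [NormedSpace ℂ Y] [Module C Y]

/-- The family `(x(t) ⊗ y(t))_t` in the `ℓ^∞`-direct sum of the projective tensor products of
Banach spaces `X(t) ⊗ Y(t)`, for `t` in the spectrum of `C`. -/
def fiberTensor (x : X) (y : Y) :
    lp (fun t : characterSpace ℂ C => Gamma ℂ (Fiber t X) (Fiber t Y)) ∞ :=
  ⟨fun t => Gamma.tmul ℂ (Fiber.mk t x) (Fiber.mk t y), memℓp_infty ⟨‖x‖ * ‖y‖, by
    rintro _ ⟨t, rfl⟩
    exact (Gamma.norm_tmul_le ℂ _ _).trans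
      (mul_le_mul (Fiber.norm_mk_le t x) (Fiber.norm_mk_le t y) (norm_nonneg _)
        (norm_nonneg _))⟩⟩

end Canonical

end CentralModule

end

open CentralModule

/-!
The spectrum of `C` is extremally disconnected, so the clopen sets give projections of `C`, and by
centrality these act as M-projections on `X` and `Y`. Consequently `γ_C(w)` is the maximum of the
seminorms of `p • w` and `(1 - p) • w`, and compactness of the spectrum gives
`γ_C(w) = sup_t γ(w(t))`, where `w(t)` is the image of `w` in `X(t) ⊗ Y(t)`.

Everything rests on the identity of `ν_C(w)` with the essential supremum of `t ↦ γ(w(t))`. A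
`C`-bilinear contraction into a normal representable bimodule is controlled by fibres over a dense
open set, because normality allows one to exhaust that set by clopen sets from below. Conversely,
the fibre norms are almost attained by functionals on single fibres, and these are glued to a
`C`-bilinear contraction into `C`: the spectrum is projective among compact Hausdorff spaces, which
provides a continuous choice of the ultrafilters along which the functionals are evaluated.
-/

noncomputable section

namespace CentralModule

open Filter Set TopologicalSpace

/-! ### The spectrum of an Abelian von Neumann algebra -/

section Characters

variable {C : Type*} [CommCStarAlgebra C]

theorem eq_of_forall_character {a b : C} (h : ∀ t : characterSpace ℂ C, t a = t b) : a = b :=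
  (gelfandStarTransform C).injective (ContinuousMap.ext h)

theorem continuous_character (a : C) : Continuous fun t : characterSpace ℂ C => t a :=
  (gelfandTransform ℂ C a).continuous

theorem character_gelfandStarTransform_symm (t : characterSpace ℂ C)
    (f : C(characterSpace ℂ C, ℂ)) : t ((gelfandStarTransform C).symm f) = f t :=
  DFunLike.congr_fun ((gelfandStarTransform C).apply_symm_apply f) t

theorem eqOn_closure_of_character_eq {a b : C} {U : Set (characterSpace ℂ C)}
    (h : ∀ t ∈ U, t a = t b) {t : characterSpace ℂ C} (ht : t ∈ closure U) : t a = t b :=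
  closure_minimal (t := {s : characterSpace ℂ C | s a = s b}) h
    (isClosed_eq (continuous_character a) (continuous_character b)) ht

theorem exists_character_eq_one_of_isOpen {U : Set (characterSpace ℂ C)} (hU : IsOpen U)
    {t : characterSpace ℂ C} (ht : t ∈ U) : ∃ c : C, (∀ s ∉ U, s c = 0) ∧ t c = 1 := by
  obtain ⟨f, hf0, hf1, -⟩ := exists_continuous_zero_one_of_isClosed hU.isClosed_compl
    (isClosed_singleton (x := t)) (by simpa using ht)
  refine ⟨(gelfandStarTransform C).symm ((ContinuousMap.mk Complex.ofReal).comp f),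
    fun s hs => ?_, ?_⟩
  · rw [character_gelfandStarTransform_symm]
    simpa using hf0 hs
  · rw [character_gelfandStarTransform_symm]
    simpa using hf1 (mem_singleton t)

/-- The projection in `C` whose Gelfand transform is the indicator function of the clopen set
`U` of characters. -/
def clopenProj (U : Clopens (characterSpace ℂ C)) : C :=
  (gelfandStarTransform C).symm (LocallyConstant.charFn ℂ U.isClopen)

variable {U V : Clopens (characterSpace ℂ C)}

theorem character_clopenProj (t : characterSpace ℂ C) (U : Clopens (characterSpace ℂ C)) :
    t (clopenProj U) = (U : Set (characterSpace ℂ C)).indicator 1 t := by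
  rw [clopenProj, character_gelfandStarTransform_symm, LocallyConstant.coe_continuousMap,
    LocallyConstant.coe_charFn]

theorem character_clopenProj_of_mem {t : characterSpace ℂ C} (h : t ∈ U) :
    t (clopenProj U) = 1 := by
  rw [character_clopenProj, indicator_of_mem (SetLike.mem_coe.2 h), Pi.one_apply]

theorem character_clopenProj_of_notMem {t : characterSpace ℂ C} (h : t ∉ U) :
    t (clopenProj U) = 0 := by
  rw [character_clopenProj, indicator_of_notMem (mt SetLike.mem_coe.1 h)]

theorem clopenProj_inf (U V : Clopens (characterSpace ℂ C)) :
    clopenProj (U ⊓ V) = clopenProj U * clopenProj V :=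
  eq_of_forall_character fun t => by
    simp only [map_mul, character_clopenProj, Clopens.coe_inf, inter_indicator_one, Pi.mul_apply]

theorem clopenProj_mul_of_le (h : U ≤ V) : clopenProj U * clopenProj V = clopenProj U := by
  rw [← clopenProj_inf, inf_eq_left.2 h]

theorem clopenProj_compl (U : Clopens (characterSpace ℂ C)) :
    clopenProj Uᶜ = 1 - clopenProj U :=
  eq_of_forall_character fun t => by
    simp only [map_sub, map_one, character_clopenProj, Clopens.coe_compl, indicator_compl,
      Pi.sub_apply, Pi.one_apply]

theorem isStarProjection_clopenProj (U : Clopens (characterSpace ℂ C)) :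
    IsStarProjection (clopenProj U) where
  isIdempotentElem := clopenProj_mul_of_le le_rfl
  isSelfAdjoint := eq_of_forall_character fun t => by
    by_cases h : t ∈ U
    · simp [map_star, character_clopenProj_of_mem h]
    · simp [map_star, character_clopenProj_of_notMem h]

theorem norm_clopenProj_le (U : Clopens (characterSpace ℂ C)) : ‖clopenProj U‖ ≤ 1 :=
  (isStarProjection_clopenProj U).norm_le

theorem norm_clopenProj_smul_le {M : Type*} [SeminormedAddCommGroup M] [Module C M]
    [IsBoundedSMul C M] (V : Clopens (characterSpace ℂ C)) (m : M) : ‖clopenProj V • m‖ ≤ ‖m‖ :=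
  (norm_smul_le _ _).trans (mul_le_of_le_one_left (norm_nonneg _) (norm_clopenProj_le V))

end Characters

section Support

variable {C : Type u} [CommCStarAlgebra C]
variable {H : Type u} [NormedAddCommGroup H] [InnerProductSpace ℂ H] [CompleteSpace H]
variable {ρ : C →⋆ₐ[ℂ] (H →L[ℂ] H)}

/-- The closed span of the ranges of the operators `ρ c` with `c ∈ S`. The orthogonal projection
onto it is the support projection of `S`. -/
def closedRange (ρ : C →⋆ₐ[ℂ] (H →L[ℂ] H)) (S : Set C) : Submodule ℂ H :=
  (Submodule.span ℂ (⋃ c ∈ S, range (ρ c))).topologicalClosure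

instance (S : Set C) : CompleteSpace (closedRange ρ S) :=
  (Submodule.isClosed_topologicalClosure _).completeSpace_coe

theorem apply_mem_closedRange {S : Set C} {c : C} (hc : c ∈ S) (x : H) :
    ρ c x ∈ closedRange ρ S :=
  Submodule.le_topologicalClosure _ (Submodule.subset_span (mem_biUnion hc (mem_range_self x)))

theorem closedRange_le_iff {S : Set C} {E : Submodule ℂ H} (hE : IsClosed (E : Set H)) :
    closedRange ρ S ≤ E ↔ ∀ c ∈ S, ∀ x, ρ c x ∈ E :=
  ⟨fun h _ hc x => h (apply_mem_closedRange hc x), fun h =>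
    Submodule.topologicalClosure_minimal _ (Submodule.span_le.2 <| iUnion₂_subset fun c hc =>
      range_subset_iff.2 (h c hc)) hE⟩

theorem exists_map_eq_starProjection_closedRange (hρ : IsVonNeumann ρ) (S : Set C) :
    ∃ q : C, ρ q = (closedRange ρ S).starProjection := by
  obtain ⟨-, N, hN⟩ := hρ
  have mem_iff (T : H →L[ℂ] H) : T ∈ N ↔ T ∈ range ρ := by rw [← hN, SetLike.mem_coe]
  refine (mem_iff _).1 ((VonNeumannAlgebra.IsStarProjection.mem_iff
    isStarProjection_starProjection N).2 fun y hy => ?_)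
  rw [Submodule.range_starProjection, Module.End.mem_invtSubmodule,
    closedRange_le_iff ((Submodule.isClosed_topologicalClosure _).preimage y.continuous)]
  intro c hc x
  have hyc : ρ c * y = y * ρ c :=
    VonNeumannAlgebra.mem_commutant_iff.1 hy _ ((mem_iff _).2 (mem_range_self c))
  rw [Submodule.mem_comap]
  exact DFunLike.congr_fun hyc x ▸ apply_mem_closedRange hc (y x)

theorem exists_supportProjection (hρ : IsVonNeumann ρ) (S : Set C) :
    ∃ q : C, ρ q = (closedRange ρ S).starProjection ∧ (∀ c ∈ S, q * c = c) ∧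
      ∀ d, (∀ c ∈ S, d * c = 0) → d * q = 0 := by
  obtain ⟨q, hq⟩ := exists_map_eq_starProjection_closedRange hρ S
  refine ⟨q, hq, fun c hc => hρ.1 (ContinuousLinearMap.ext fun x => ?_),
    fun d hd => hρ.1 (ContinuousLinearMap.ext fun x => ?_)⟩
  · rw [map_mul, hq, mul_apply_eq_comp]
    exact Submodule.starProjection_eq_self_iff.2 (apply_mem_closedRange hc x)
  · have hle : closedRange ρ S ≤ LinearMap.ker (ρ d : H →ₗ[ℂ] H) :=
      (closedRange_le_iff (ρ d).isClosed_ker).2 fun c hc y => by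
        simpa [hd c hc] using (DFunLike.congr_fun (map_mul ρ d c) y).symm
    rw [map_mul, hq, map_zero, mul_apply_eq_comp]
    exact hle (Submodule.starProjection_apply_mem _ x)

theorem extremallyDisconnected_characterSpace (hρ : IsVonNeumann ρ) :
    ExtremallyDisconnected (characterSpace ℂ C) := by
  refine ⟨fun U hU => ?_⟩
  obtain ⟨q, -, hq_one, hq_zero⟩ := exists_supportProjection hρ {c | ∀ t ∉ U, t c = 0}
  have h_one : ∀ t ∈ closure U, t q = 1 := fun t ht =>
    (eqOn_closure_of_character_eq (b := 1) (fun s hs => by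
      obtain ⟨c, hc, hsc⟩ := exists_character_eq_one_of_isOpen hU hs
      simpa [hsc] using congrArg s (hq_one c hc)) ht).trans (map_one t)
  have h_zero : ∀ t ∉ closure U, t q = 0 := fun t ht => by
    obtain ⟨d, hd, htd⟩ := exists_character_eq_one_of_isOpen isClosed_closure.isOpen_compl ht
    have hdq : d * q = 0 := hq_zero d fun c hc => eq_of_forall_character fun s => by
      by_cases hs : s ∈ U
      · simp [hd s (not_not.2 (subset_closure hs))]
      · simp [hc s hs]
    simpa [htd] using congrArg t hdq
  have : closure U = {t : characterSpace ℂ C | t q ≠ 0} := by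
    ext t
    refine ⟨fun ht => by simp [h_one t ht], fun ht => ?_⟩
    by_contra hn
    exact ht (h_zero t hn)
  rw [this]
  exact isOpen_ne_fun (continuous_character q) continuous_const

end Support

/-! ### M-projections -/

section MProjection

theorem norm_sq_apply_add_norm_sq_one_sub_apply {K : Type*} [NormedAddCommGroup K]
    [InnerProductSpace ℂ K] [CompleteSpace K] {e : K →L[ℂ] K} (he : IsStarProjection e) (x : K) :
    ‖e x‖ ^ 2 + ‖(1 - e) x‖ ^ 2 = ‖x‖ ^ 2 := by
  obtain ⟨E, _, rfl⟩ := isStarProjection_iff_eq_starProjection.1 he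
  rw [E.norm_sq_eq_add_norm_sq_starProjection x, ← Submodule.starProjection_orthogonal']

theorem norm_smul_add_one_sub_smul_le {R X : Type*} [Ring R] [NormedAddCommGroup X] [Module R X]
    {p : R} (hp : IsMprojection X p) (x y : X) : ‖p • x + (1 - p) • y‖ ≤ max ‖x‖ ‖y‖ := by
  have hp_left : p • (p • x + (1 - p) • y) = p • x := by
    rw [smul_add, smul_smul, smul_smul, hp.proj.eq, hp.proj.mul_one_sub_self, zero_smul, add_zero]
  have hp_right : (1 - p) • (p • x + (1 - p) • y) = (1 - p) • y := by
    rw [smul_add, smul_smul, smul_smul, hp.proj.one_sub_mul_self, hp.proj.one_sub.eq, zero_smul,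
      zero_add]
  rw [hp.Mnorm (p • x + (1 - p) • y), hp_left, hp_right]
  exact max_le_max ((le_max_left _ _).trans_eq (hp.Mnorm x).symm)
    ((le_max_right _ _).trans_eq (hp.Mnorm y).symm)

variable {C : Type u} [CommCStarAlgebra C]
variable {V : Type u} [NormedAddCommGroup V] [NormedSpace ℂ V] [Module C V] [Module Cᵐᵒᵖ V]

theorem IsNormalRepresentable.isRepresentable {H : Type u} [NormedAddCommGroup H]
    [InnerProductSpace ℂ H] [CompleteSpace H] {ρ : C →⋆ₐ[ℂ] (H →L[ℂ] H)}
    (h : IsNormalRepresentable ρ V) : IsRepresentable C V := by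
  obtain ⟨K, i1, i2, i3, L, i4, i5, i6, π, σ, J, -, -, hl, hr⟩ := h
  exact ⟨K, i1, i2, i3, L, i4, i5, i6, π, σ, J, hl, hr⟩

theorem IsRepresentable.isScalarTower (h : IsRepresentable C V) : IsScalarTower ℂ C V := by
  obtain ⟨K, _, _, _, L, _, _, _, π, σ, J, hl, -⟩ := h
  refine ⟨fun z c v => J.injective ?_⟩
  rw [hl, map_smul, map_smul, hl, ContinuousLinearMap.smul_comp]

theorem IsRepresentable.isBoundedSMul (h : IsRepresentable C V) : IsBoundedSMul C V := by
  obtain ⟨K, _, _, _, L, _, _, _, π, σ, J, hl, -⟩ := h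
  refine IsBoundedSMul.of_norm_smul_le fun c v => ?_
  calc ‖c • v‖ = ‖(π c).comp (J v)‖ := by rw [← hl, J.norm_map]
    _ ≤ ‖π c‖ * ‖J v‖ := ContinuousLinearMap.opNorm_comp_le _ _
    _ ≤ ‖c‖ * ‖v‖ := by
      rw [J.norm_map]
      gcongr
      exact NonUnitalStarAlgHom.norm_apply_le π c

theorem IsRepresentable.isMprojection [IsCentralScalar C V] (h : IsRepresentable C V) {e : C}
    (he : IsStarProjection e) : IsMprojection V e := by
  have := h.isBoundedSMul
  have norm_smul_le_norm {f : C} (hf : IsStarProjection f) (v : V) : ‖f • v‖ ≤ ‖v‖ :=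
    (norm_smul_le _ _).trans (mul_le_of_le_one_left (norm_nonneg _) hf.norm_le)
  refine ⟨he.isIdempotentElem, fun v => le_antisymm ?_
    (max_le (norm_smul_le_norm he v) (norm_smul_le_norm he.one_sub v))⟩
  obtain ⟨K, _, _, _, L, _, _, _, π, σ, J, hl, hr⟩ := h
  -- Centrality moves the projection to the right of `J v` as well.
  have norm_sq_le {f : C} (hf : IsStarProjection f) (ξ : L) :
      ‖π f (J v ξ)‖ ^ 2 ≤ (‖f • v‖ * ‖σ f ξ‖) ^ 2 := by
    have : π f (J v ξ) = J (f • v) (σ f ξ) := calc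
      π f (J v ξ) = J (op f • f • v) ξ := by
        rw [op_smul_eq_smul, smul_smul, hf.isIdempotentElem.eq, hl]
        rfl
      _ = J (f • v) (σ f ξ) := by
        rw [hr]
        rfl
    rw [this, ← J.norm_map (f • v)]
    gcongr
    exact ContinuousLinearMap.le_opNorm _ _
  set r := max ‖e • v‖ ‖(1 - e) • v‖
  rw [← J.norm_map]
  refine ContinuousLinearMap.opNorm_le_bound _ (le_max_of_le_left (norm_nonneg _)) fun ξ =>
    le_of_sq_le_sq ?_ (by positivity)
  calc ‖J v ξ‖ ^ 2 = ‖π e (J v ξ)‖ ^ 2 + ‖π (1 - e) (J v ξ)‖ ^ 2 := by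
        rw [map_sub, map_one, norm_sq_apply_add_norm_sq_one_sub_apply (he.map π)]
    _ ≤ (‖e • v‖ * ‖σ e ξ‖) ^ 2 + (‖(1 - e) • v‖ * ‖σ (1 - e) ξ‖) ^ 2 :=
        add_le_add (norm_sq_le he ξ) (norm_sq_le he.one_sub ξ)
    _ ≤ (r * ‖σ e ξ‖) ^ 2 + (r * ‖σ (1 - e) ξ‖) ^ 2 := by
        gcongr
        exacts [le_max_left _ _, le_max_right _ _]
    _ = (r * ‖ξ‖) ^ 2 := by
        rw [mul_pow, mul_pow, mul_pow, ← mul_add, map_sub, map_one,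
          norm_sq_apply_add_norm_sq_one_sub_apply (he.map σ)]

end MProjection

/-! ### The projective seminorm -/

section GammaNorm

variable {R : Type*} [CommRing R] {X Y : Type u} [NormedAddCommGroup X] [Module R X]
  [NormedAddCommGroup Y] [Module R Y]

theorem gammaNorm_tmul_le (x : X) (y : Y) : gammaNorm (x ⊗ₜ[R] y) ≤ ‖x‖ * ‖y‖ := by
  simpa using gammaNorm_le (R := R) (fun _ : Fin 1 => x) (fun _ => y)

theorem norm_le_mul_gammaNorm {G : Type*} [SeminormedAddCommGroup G] (f : X ⊗[R] Y →+ G) {A : ℝ}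
    (hA : 0 ≤ A) (hf : ∀ x y, ‖f (x ⊗ₜ y)‖ ≤ A * (‖x‖ * ‖y‖)) (w : X ⊗[R] Y) :
    ‖f w‖ ≤ A * gammaNorm w := by
  have norm_le_sum (n : ℕ) (x : Fin n → X) (y : Fin n → Y) (hw : w = ∑ j, x j ⊗ₜ[R] y j) :
      ‖f w‖ ≤ A * ∑ j, ‖x j‖ * ‖y j‖ := by
    rw [hw, map_sum, Finset.mul_sum]
    exact (norm_sum_le _ _).trans (Finset.sum_le_sum fun j _ => hf _ _)
  rcases hA.eq_or_lt with rfl | hA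
  · obtain ⟨n, x, y, hw⟩ := exists_rep w
    simpa using norm_le_sum n x y hw
  · rw [← div_le_iff₀' hA]
    exact le_gammaNorm fun n x y hw => (div_le_iff₀' hA).2 (norm_le_sum n x y hw)

variable [Algebra ℝ R] [NormedSpace ℝ X] [IsScalarTower ℝ R X]

/-- The convex hull of the elementary tensors of two vectors of the closed unit balls. It lies
between the open and the closed unit ball of `gammaNorm`. -/
def tensorHull (R : Type*) [CommRing R] [Algebra ℝ R] (X Y : Type u) [NormedAddCommGroup X]
    [Module R X] [NormedSpace ℝ X] [IsScalarTower ℝ R X] [NormedAddCommGroup Y] [Module R Y] :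
    Set (X ⊗[R] Y) :=
  convexHull ℝ (image2 (fun x y => x ⊗ₜ[R] y) (Metric.closedBall 0 1) (Metric.closedBall 0 1))

theorem gammaNorm_le_one_of_mem_tensorHull {w : X ⊗[R] Y} (hw : w ∈ tensorHull R X Y) :
    gammaNorm w ≤ 1 := by
  refine convexHull_min (t := {w | gammaNorm w ≤ 1}) ?_ (fun u hu v hv a b ha hb hab => ?_) hw
  · rintro _ ⟨x, hx, y, hy, rfl⟩
    exact (gammaNorm_tmul_le x y).trans (mul_le_one₀ (mem_closedBall_zero_iff.1 hx)
      (norm_nonneg _) (mem_closedBall_zero_iff.1 hy))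
  · calc gammaNorm (a • u + b • v) ≤ ‖a‖ * gammaNorm u + ‖b‖ * gammaNorm v :=
          (gammaNorm_add_le _ _).trans (add_le_add (gammaNorm_smul_le a u) (gammaNorm_smul_le b v))
      _ ≤ a * 1 + b * 1 := by
          rw [Real.norm_of_nonneg ha, Real.norm_of_nonneg hb]
          gcongr
          exacts [hu, hv]
      _ = 1 := by rw [mul_one, mul_one, hab]

theorem smul_add_one_sub_smul_mem_tensorHull {p : R} (hX : IsMprojection X p)
    (hY : IsMprojection Y p) {u v : X ⊗[R] Y} (hu : u ∈ tensorHull R X Y)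
    (hv : v ∈ tensorHull R X Y) : p • u + (1 - p) • v ∈ tensorHull R X Y := by
  let f : (X ⊗[R] Y) × (X ⊗[R] Y) →ₗ[ℝ] X ⊗[R] Y :=
    (DistribSMul.toLinearMap ℝ _ p).coprod (DistribSMul.toLinearMap ℝ _ (1 - p))
  have hf : f (u, v) ∈ f '' (tensorHull R X Y ×ˢ tensorHull R X Y) := mem_image_of_mem f ⟨hu, hv⟩
  rw [tensorHull, ← convexHull_prod, f.image_convexHull] at hf
  refine convexHull_mono ?_ hf
  rintro _ ⟨⟨_, _⟩, ⟨⟨x, hx, y, hy, rfl⟩, x', hx', y', hy', rfl⟩, rfl⟩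
  rw [mem_closedBall_zero_iff] at hx hy hx' hy'
  refine ⟨p • x + (1 - p) • x', mem_closedBall_zero_iff.2
    ((norm_smul_add_one_sub_smul_le hX x x').trans (max_le hx hx')), p • y + (1 - p) • y',
    mem_closedBall_zero_iff.2 ((norm_smul_add_one_sub_smul_le hY y y').trans (max_le hy hy')), ?_⟩
  simp only [f, LinearMap.coprod_apply, DistribSMul.toLinearMap_apply, TensorProduct.add_tmul,
    TensorProduct.tmul_add, ← TensorProduct.smul_tmul', TensorProduct.tmul_smul, smul_add,
    smul_smul, hX.proj.eq, hX.proj.one_sub.eq, hX.proj.mul_one_sub_self,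
    hX.proj.one_sub_mul_self, zero_smul, add_zero, zero_add]

theorem mem_tensorHull_of_gammaNorm_lt_one [NormedSpace ℝ Y] [IsScalarTower ℝ R Y] {w : X ⊗[R] Y}
    (hw : gammaNorm w < 1) : w ∈ tensorHull R X Y := by
  obtain ⟨n, x, y, rfl, hlt⟩ : ∃ (n : ℕ) (x : Fin n → X) (y : Fin n → Y),
      w = ∑ j, x j ⊗ₜ[R] y j ∧ ∑ j, ‖x j‖ * ‖y j‖ < 1 := by
    contrapose! hw
    exact le_gammaNorm hw
  have norm_normalize_le {E : Type u} [NormedAddCommGroup E] [NormedSpace ℝ E] (z : E) :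
      ‖NormedSpace.normalize z‖ ≤ 1 := by
    rcases eq_or_ne z 0 with rfl | hz
    · simp
    · exact (NormedSpace.norm_normalize_eq_one_iff.2 hz).le
  have tmul_mem {a : X} {b : Y} (ha : ‖a‖ ≤ 1) (hb : ‖b‖ ≤ 1) : a ⊗ₜ[R] b ∈ tensorHull R X Y :=
    subset_convexHull ℝ _ ⟨a, mem_closedBall_zero_iff.2 ha, b, mem_closedBall_zero_iff.2 hb, rfl⟩
  have tmul_eq (a : X) (b : Y) : a ⊗ₜ[R] b =
      (‖a‖ * ‖b‖) • (NormedSpace.normalize a ⊗ₜ[R] NormedSpace.normalize b) := by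
    rw [mul_smul, ← TensorProduct.tmul_smul, TensorProduct.smul_tmul',
      NormedSpace.norm_smul_normalize, NormedSpace.norm_smul_normalize]
  have hsum := (convex_convexHull ℝ _).sum_mem (t := (Finset.univ : Finset (Option (Fin n))))
    (w := fun j => j.elim (1 - ∑ j, ‖x j‖ * ‖y j‖) fun j => ‖x j‖ * ‖y j‖)
    (z := fun j => j.elim (0 ⊗ₜ[R] 0) fun j =>
      NormedSpace.normalize (x j) ⊗ₜ[R] NormedSpace.normalize (y j))
    (by rintro (_ | j) -
        exacts [sub_nonneg.2 hlt.le, mul_nonneg (norm_nonneg _) (norm_nonneg _)])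
    (by simp [Fintype.sum_option])
    (by rintro (_ | j) -
        exacts [tmul_mem (by simp) (by simp),
          tmul_mem (norm_normalize_le _) (norm_normalize_le _)])
  simpa [tensorHull, Fintype.sum_option, ← tmul_eq] using hsum

theorem gammaNorm_le_max [NormedSpace ℝ Y] [IsScalarTower ℝ R Y] {p : R}
    (hX : IsMprojection X p) (hY : IsMprojection Y p) (w : X ⊗[R] Y) :
    gammaNorm w ≤ max (gammaNorm (p • w)) (gammaNorm ((1 - p) • w)) := by
  refine le_of_forall_gt_imp_ge_of_dense fun r hr => ?_
  have hr0 : 0 < r := (le_max_of_le_left (gammaNorm_nonneg _)).trans_lt hr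
  have inv_smul_mem {v : X ⊗[R] Y} (hv : gammaNorm v < r) : r⁻¹ • v ∈ tensorHull R X Y := by
    refine mem_tensorHull_of_gammaNorm_lt_one ((gammaNorm_smul_le _ _).trans_lt ?_)
    rwa [norm_inv, Real.norm_of_nonneg hr0.le, inv_mul_lt_one₀ hr0]
  have hmem := smul_add_one_sub_smul_mem_tensorHull hX hY
    (inv_smul_mem ((le_max_left _ _).trans_lt hr)) (inv_smul_mem ((le_max_right _ _).trans_lt hr))
  rw [smul_comm p, smul_comm (1 - p), smul_smul, smul_smul, hX.proj.eq, hX.proj.one_sub.eq,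
    ← smul_add, ← add_smul, add_sub_cancel, one_smul] at hmem
  calc gammaNorm w = gammaNorm (r • r⁻¹ • w) := by rw [smul_inv_smul₀ hr0.ne']
    _ ≤ ‖r‖ * gammaNorm (r⁻¹ • w) := gammaNorm_smul_le _ _
    _ ≤ r * 1 := by
        rw [Real.norm_of_nonneg hr0.le]
        gcongr
        exact gammaNorm_le_one_of_mem_tensorHull hmem
    _ = r := mul_one r

end GammaNorm

/-! ### Fibres of the projective tensor product -/

section LocallyNull

variable {C : Type u} [CommCStarAlgebra C]
variable {M : Type*} [SeminormedAddCommGroup M] [Module C M] [IsBoundedSMul C M]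

theorem norm_clopenProj_smul_mono {V W : Clopens (characterSpace ℂ C)} (h : V ≤ W) (m : M) :
    ‖clopenProj V • m‖ ≤ ‖clopenProj W • m‖ := by
  rw [← clopenProj_mul_of_le h, mul_smul]
  exact norm_clopenProj_smul_le V _

/-- The submodule of those `m` whose restrictions to small clopen neighbourhoods of `t` have
arbitrarily small norm. -/
def locallyNull (t : characterSpace ℂ C) (M : Type*) [SeminormedAddCommGroup M] [Module C M]
    [IsBoundedSMul C M] : Submodule C M where
  carrier := {m | ∀ ε > 0, ∃ V : Clopens (characterSpace ℂ C), t ∈ V ∧ ‖clopenProj V • m‖ < ε}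
  zero_mem' ε hε := ⟨⊤, mem_univ t, by simpa using hε⟩
  add_mem' {m n} hm hn ε hε := by
    obtain ⟨V, hV, hVm⟩ := hm (ε / 2) (half_pos hε)
    obtain ⟨W, hW, hWn⟩ := hn (ε / 2) (half_pos hε)
    refine ⟨V ⊓ W, ⟨hV, hW⟩, ?_⟩
    calc ‖clopenProj (V ⊓ W) • (m + n)‖
        ≤ ‖clopenProj (V ⊓ W) • m‖ + ‖clopenProj (V ⊓ W) • n‖ :=
          smul_add (clopenProj (V ⊓ W)) m n ▸ norm_add_le _ _
      _ ≤ ‖clopenProj V • m‖ + ‖clopenProj W • n‖ :=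
          add_le_add (norm_clopenProj_smul_mono inf_le_left m)
            (norm_clopenProj_smul_mono inf_le_right n)
      _ < ε := by linarith
  smul_mem' c m hm ε hε := by
    obtain ⟨V, hV, hVm⟩ := hm (ε / (‖c‖ + 1)) (by positivity)
    refine ⟨V, hV, ?_⟩
    calc ‖clopenProj V • c • m‖ ≤ ‖c‖ * ‖clopenProj V • m‖ := by
          rw [smul_comm]
          exact norm_smul_le _ _
      _ ≤ (‖c‖ + 1) * ‖clopenProj V • m‖ := by gcongr; linarith
      _ < ε := (lt_div_iff₀' (by positivity)).1 hVm

variable {t : characterSpace ℂ C}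

theorem isClosed_locallyNull : IsClosed (locallyNull t M : Set M) := by
  refine isClosed_of_closure_subset fun m hm ε hε => ?_
  obtain ⟨n, hn, hmn⟩ := Metric.mem_closure_iff.1 hm (ε / 2) (half_pos hε)
  obtain ⟨V, hV, hVn⟩ := hn (ε / 2) (half_pos hε)
  refine ⟨V, hV, ?_⟩
  calc ‖clopenProj V • m‖ = ‖clopenProj V • (m - n) + clopenProj V • n‖ := by
        rw [← smul_add, sub_add_cancel]
    _ ≤ ‖m - n‖ + ‖clopenProj V • n‖ :=
        (norm_add_le _ _).trans (add_le_add_left (norm_clopenProj_smul_le V _) _)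
    _ < ε := by
        rw [← dist_eq_norm]
        linarith

theorem mem_locallyNull_of_norm_smul_le {N : Type*} [SeminormedAddCommGroup N] [Module C N]
    [IsBoundedSMul C N] {m : M} {n : N} (hm : m ∈ locallyNull t M) {a : ℝ} (ha : 0 ≤ a)
    (h : ∀ c : C, ‖c • n‖ ≤ a * ‖c • m‖) : n ∈ locallyNull t N := by
  intro ε hε
  obtain ⟨V, hV, hVm⟩ := hm (ε / (a + 1)) (by positivity)
  refine ⟨V, hV, (h _).trans_lt ?_⟩
  calc a * ‖clopenProj V • m‖ ≤ (a + 1) * ‖clopenProj V • m‖ := by gcongr; linarith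
    _ < ε := (lt_div_iff₀' (by positivity)).1 hVm

theorem norm_le_of_forall_character {a : C} {r : ℝ} (hr : 0 ≤ r)
    (h : ∀ t : characterSpace ℂ C, ‖t a‖ ≤ r) : ‖a‖ ≤ r := by
  rw [← (gelfandTransform_isometry C).norm_map_of_map_zero (map_zero _) a]
  exact (ContinuousMap.norm_le _ hr).2 h

theorem mem_locallyNull_of_character_eq_zero [TotallyDisconnectedSpace (characterSpace ℂ C)]
    {c : C} (hc : t c = 0) : c ∈ locallyNull t C := by
  intro ε hε
  obtain ⟨V, hV, htV, hVc⟩ := compact_exists_isClopen_in_isOpen (x := t)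
    (isOpen_lt (continuous_character c).norm continuous_const)
    (show ‖t c‖ < ε / 2 by simpa [hc] using half_pos hε)
  refine ⟨⟨V, hV⟩, htV, lt_of_le_of_lt ?_ (half_lt_self hε)⟩
  refine norm_le_of_forall_character (half_pos hε).le fun s => ?_
  rw [smul_eq_mul, map_mul]
  by_cases hs : s ∈ V
  · rw [character_clopenProj_of_mem hs, one_mul]
    exact le_of_lt (hVc hs)
  · rw [character_clopenProj_of_notMem hs, zero_mul, norm_zero]
    exact (half_pos hε).le

theorem fiberKer_le_locallyNull [TotallyDisconnectedSpace (characterSpace ℂ C)] {X : Type u}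
    [NormedAddCommGroup X] [NormedSpace ℂ X] [Module C X] [IsScalarTower ℂ C X]
    [IsBoundedSMul C X] : fiberKer t X ≤ (locallyNull t X).restrictScalars ℂ := by
  refine Submodule.topologicalClosure_minimal _ (Submodule.span_le.2 ?_) isClosed_locallyNull
  rintro _ ⟨c, x, hc, rfl⟩
  refine mem_locallyNull_of_norm_smul_le (mem_locallyNull_of_character_eq_zero hc)
    (norm_nonneg x) fun d => ?_
  rw [smul_smul, mul_comm ‖x‖]
  exact norm_smul_le _ _

theorem norm_le_of_forall_exists_clopen
    (hM : ∀ (V : Clopens (characterSpace ℂ C)) (m : M),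
      ‖m‖ ≤ max ‖clopenProj V • m‖ ‖(1 - clopenProj V) • m‖)
    {m : M} {r : ℝ} (hr : 0 ≤ r)
    (h : ∀ t : characterSpace ℂ C, ∃ V : Clopens (characterSpace ℂ C),
      t ∈ V ∧ ‖clopenProj V • m‖ ≤ r) : ‖m‖ ≤ r := by
  obtain ⟨V, huniv, hV⟩ : ∃ V : Clopens (characterSpace ℂ C),
      univ ⊆ (V : Set (characterSpace ℂ C)) ∧ ‖clopenProj V • m‖ ≤ r := by
    refine isCompact_univ.induction_on (p := fun S => ∃ V : Clopens (characterSpace ℂ C),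
      S ⊆ (V : Set (characterSpace ℂ C)) ∧ ‖clopenProj V • m‖ ≤ r) ?_ ?_ ?_ ?_
    · refine ⟨⊥, empty_subset _, ?_⟩
      rwa [show clopenProj (⊥ : Clopens (characterSpace ℂ C)) = 0 from
        eq_of_forall_character fun t => by simp [character_clopenProj], zero_smul, norm_zero]
    · rintro S T hST ⟨V, hTV, hV⟩
      exact ⟨V, hST.trans hTV, hV⟩
    · rintro S T ⟨V, hSV, hV⟩ ⟨W, hTW, hW⟩
      refine ⟨V ⊔ W, union_subset_union hSV hTW, (hM V _).trans (max_le ?_ ?_)⟩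
      · rw [smul_smul, ← clopenProj_inf]
        exact (norm_clopenProj_smul_mono inf_le_left m).trans hV
      · rw [← clopenProj_compl, smul_smul, ← clopenProj_inf, inf_sup_left, compl_inf_self,
          bot_sup_eq]
        exact (norm_clopenProj_smul_mono inf_le_right m).trans hW
    · intro t _
      obtain ⟨V, htV, hV⟩ := h t
      exact ⟨V, mem_nhdsWithin_of_mem_nhds (V.isClopen.isOpen.mem_nhds htV), V, subset_rfl, hV⟩
  rwa [show clopenProj V = 1 from eq_of_forall_character fun t => by
    rw [character_clopenProj_of_mem (huniv (mem_univ t)), map_one], one_smul] at hV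

variable {X Y : Type u} [NormedAddCommGroup X] [Module C X] [IsBoundedSMul C X]
  [NormedAddCommGroup Y] [Module C Y]

theorem tmul_mem_locallyNull_left {x : X} (hx : x ∈ locallyNull t X) (y : Y) :
    x ⊗ₜ[C] y ∈ locallyNull t (GammaPre C X Y) :=
  mem_locallyNull_of_norm_smul_le (N := GammaPre C X Y) hx (norm_nonneg y) fun c => by
    rw [mul_comm]
    exact gammaNorm_tmul_le (c • x) y

theorem tmul_mem_locallyNull_right [IsBoundedSMul C Y] (x : X) {y : Y} (hy : y ∈ locallyNull t Y) :
    x ⊗ₜ[C] y ∈ locallyNull t (GammaPre C X Y) :=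
  mem_locallyNull_of_norm_smul_le (N := GammaPre C X Y) hy (norm_nonneg x) fun c =>
    (congrArg gammaNorm (TensorProduct.tmul_smul c x y).symm).trans_le
      (gammaNorm_tmul_le x (c • y))

end LocallyNull

section FiberMap

variable {C : Type u} [CommCStarAlgebra C] (t : characterSpace ℂ C)
variable {X : Type u} [NormedAddCommGroup X] [NormedSpace ℂ X] [Module C X] [IsScalarTower ℂ C X]
variable {Y : Type u} [NormedAddCommGroup Y] [NormedSpace ℂ Y] [Module C Y] [IsScalarTower ℂ C Y]

theorem Fiber.mk_smul (c : C) (x : X) : Fiber.mk t (c • x) = t c • Fiber.mk t x := by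
  have hmem : c • x - t c • x ∈ fiberKer t X := by
    refine Submodule.le_topologicalClosure _
      (Submodule.subset_span ⟨c - algebraMap ℂ C (t c), x, ?_, ?_⟩)
    · rw [map_sub, AlgHomClass.commutes, Algebra.algebraMap_self_apply, sub_self]
    · rw [sub_smul, algebraMap_smul]
  rw [Fiber.mk, Fiber.mk, ← map_smul, ← sub_eq_zero, ← map_sub]
  exact (Submodule.Quotient.mk_eq_zero _).2 hmem

/-- The map `x ⊗ y ↦ x(t) ⊗ y(t)`, semilinear along the character `t`. -/
def fiberMap : X ⊗[C] Y →ₛₗ[(t : C →+* ℂ)] Fiber t X ⊗[ℂ] Fiber t Y :=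
  TensorProduct.lift <| LinearMap.mk₂'ₛₗ _ _ (fun x y => Fiber.mk t x ⊗ₜ[ℂ] Fiber.mk t y)
    (fun x x' y => by rw [Fiber.mk, map_add, TensorProduct.add_tmul]; rfl)
    (fun c x y => by rw [Fiber.mk_smul, TensorProduct.smul_tmul']; rfl)
    (fun x y y' => by rw [Fiber.mk, Fiber.mk, map_add, TensorProduct.tmul_add]; rfl)
    (fun c x y => by rw [Fiber.mk_smul, TensorProduct.tmul_smul]; rfl)

theorem fiberMap_tmul (x : X) (y : Y) :
    fiberMap t (x ⊗ₜ[C] y) = Fiber.mk t x ⊗ₜ[ℂ] Fiber.mk t y := rfl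

theorem fiberMap_smul (c : C) (w : X ⊗[C] Y) : fiberMap t (c • w) = t c • fiberMap t w :=
  map_smulₛₗ _ c w

theorem fiberMap_mapOfCompatibleSMul (v : X ⊗[ℂ] Y) :
    fiberMap t (TensorProduct.mapOfCompatibleSMul C ℂ ℂ X Y v) =
      TensorProduct.map (fiberKer t X).mkQ (fiberKer t Y).mkQ v := by
  induction v with
  | zero => simp only [map_zero]
  | tmul x y => rfl
  | add v w hv hw => simp only [map_add, hv, hw]

theorem gammaNorm_fiberMap_le (w : X ⊗[C] Y) : gammaNorm (fiberMap t w) ≤ gammaNorm w := by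
  refine le_gammaNorm fun n x y hw => ?_
  rw [hw, map_sum]
  refine (gammaNorm_le (R := ℂ) (fun j => Fiber.mk t (x j)) (fun j => Fiber.mk t (y j))).trans ?_
  gcongr <;> exact Fiber.norm_mk_le t _

variable {t}

theorem exists_fiberMap_eq_of_gammaNorm_lt {w : Fiber t X ⊗[ℂ] Fiber t Y} {r : ℝ}
    (hw : gammaNorm w < r) : ∃ v : X ⊗[C] Y, fiberMap t v = w ∧ gammaNorm v < r := by
  obtain ⟨n, a, b, rfl, hr⟩ : ∃ (n : ℕ) (a : Fin n → Fiber t X) (b : Fin n → Fiber t Y),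
      w = ∑ j, a j ⊗ₜ[ℂ] b j ∧ ∑ j, ‖a j‖ * ‖b j‖ < r := by
    contrapose! hw
    exact le_gammaNorm hw
  have hcont : Tendsto (fun δ : ℝ => ∑ j, (‖a j‖ + δ) * (‖b j‖ + δ)) (𝓝[>] 0)
      (𝓝 (∑ j, ‖a j‖ * ‖b j‖)) :=
    (Continuous.tendsto' (by fun_prop) _ _ (by simp only [add_zero])).mono_left
      nhdsWithin_le_nhds
  obtain ⟨δ, hδ, hδ0 : 0 < δ⟩ :=
    ((hcont.eventually (gt_mem_nhds hr)).and self_mem_nhdsWithin).exists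
  choose x hx hxn using fun j => Submodule.Quotient.norm_mk_lt (a j) hδ0
  choose y hy hyn using fun j => Submodule.Quotient.norm_mk_lt (b j) hδ0
  refine ⟨∑ j, x j ⊗ₜ[C] y j, ?_, (gammaNorm_le x y).trans_lt (lt_of_le_of_lt ?_ hδ)⟩
  · simp only [map_sum, fiberMap_tmul, ← hx, ← hy]
    rfl
  · gcongr with j
    exacts [(hxn j).le, (hyn j).le]

instance : IsScalarTower ℂ C (GammaPre C X Y) :=
  inferInstanceAs (IsScalarTower ℂ C (X ⊗[C] Y))

variable [IsBoundedSMul C X] [IsBoundedSMul C Y]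
variable [TotallyDisconnectedSpace (characterSpace ℂ C)]

theorem mem_locallyNull_of_fiberMap_eq_zero {w : X ⊗[C] Y} (hw : fiberMap t w = 0) :
    w ∈ locallyNull t (GammaPre C X Y) := by
  obtain ⟨v, rfl⟩ := TensorProduct.mapOfCompatibleSMul_surjective C ℂ ℂ X Y w
  suffices hker : LinearMap.ker (TensorProduct.map (fiberKer t X).mkQ (fiberKer t Y).mkQ) ≤
      ((locallyNull t (GammaPre C X Y)).restrictScalars ℂ).comap
        (TensorProduct.mapOfCompatibleSMul C ℂ ℂ X Y) from
    hker (LinearMap.mem_ker.2 ((fiberMap_mapOfCompatibleSMul t v).symm.trans hw))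
  rw [TensorProduct.map_ker (LinearMap.exact_subtype_mkQ _) (Submodule.mkQ_surjective _)
    (LinearMap.exact_subtype_mkQ _) (Submodule.mkQ_surjective _), LinearMap.lTensor,
    LinearMap.rTensor, TensorProduct.range_map_eq_span_tmul, TensorProduct.range_map_eq_span_tmul]
  refine sup_le (Submodule.span_le.2 ?_) (Submodule.span_le.2 ?_)
  · rintro _ ⟨x, y, rfl⟩
    exact tmul_mem_locallyNull_right (C := C) x (fiberKer_le_locallyNull y.2)
  · rintro _ ⟨x, y, rfl⟩
    exact tmul_mem_locallyNull_left (C := C) (fiberKer_le_locallyNull x.2) y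

theorem exists_clopen_gammaNorm_lt {w : X ⊗[C] Y} {r : ℝ} (hw : gammaNorm (fiberMap t w) < r) :
    ∃ V : Clopens (characterSpace ℂ C), t ∈ V ∧ gammaNorm (clopenProj V • w) < r := by
  obtain ⟨v, hv, hvr⟩ := exists_fiberMap_eq_of_gammaNorm_lt hw
  have hwv : fiberMap t (w - v) = 0 := by rw [map_sub, hv, sub_self]
  obtain ⟨V, hV, hVwv : gammaNorm (clopenProj V • (w - v)) < r - gammaNorm v⟩ :=
    mem_locallyNull_of_fiberMap_eq_zero hwv (r - gammaNorm v) (sub_pos.2 hvr)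
  refine ⟨V, hV, ?_⟩
  calc gammaNorm (clopenProj V • w)
      = gammaNorm (clopenProj V • (w - v) + clopenProj V • v) := by
        rw [← smul_add, sub_add_cancel]
    _ ≤ gammaNorm (clopenProj V • (w - v)) + gammaNorm v :=
        (gammaNorm_add_le _ _).trans (add_le_add_right
          (norm_clopenProj_smul_le (M := GammaPre C X Y) V v) _)
    _ < r := by linarith

theorem upperSemicontinuous_gammaNorm_fiberMap (w : X ⊗[C] Y) :
    UpperSemicontinuous fun t : characterSpace ℂ C => gammaNorm (fiberMap t w) := by
  intro t r hr
  obtain ⟨V, hV, hVw⟩ := exists_clopen_gammaNorm_lt hr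
  filter_upwards [V.isClopen.isOpen.mem_nhds hV] with s hs
  calc gammaNorm (fiberMap s w) = gammaNorm (fiberMap s (clopenProj V • w)) := by
        rw [fiberMap_smul, character_clopenProj_of_mem hs, one_smul]
    _ < r := (gammaNorm_fiberMap_le s _).trans_lt hVw

theorem gammaNorm_le_of_fiberMap_le [Module Cᵐᵒᵖ X] [IsCentralScalar C X] [Module Cᵐᵒᵖ Y]
    [IsCentralScalar C Y] (hX : IsRepresentable C X) (hY : IsRepresentable C Y) {w : X ⊗[C] Y}
    {r : ℝ} (hr : 0 ≤ r) (hw : ∀ t : characterSpace ℂ C, gammaNorm (fiberMap t w) ≤ r) :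
    gammaNorm w ≤ r := by
  refine le_of_forall_pos_le_add fun ε hε => ?_
  refine norm_le_of_forall_exists_clopen (C := C) (M := GammaPre C X Y) (m := w) (fun V v => ?_)
    (by positivity) fun t => ?_
  · exact gammaNorm_le_max (hX.isMprojection (isStarProjection_clopenProj V))
      (hY.isMprojection (isStarProjection_clopenProj V)) v
  · exact (exists_clopen_gammaNorm_lt ((hw t).trans_lt (lt_add_of_pos_right r hε))).imp
      fun V hV => ⟨hV.1, hV.2.le⟩

end FiberMap

/-! ### Weak* convergence of projections -/

section Normality

/-- The clopen subsets of `U`, a directed set. For `U` dense and open in the spectrum of an Abelian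
von Neumann algebra, the corresponding projections increase to `1`. -/
abbrev ClopensWithin {α : Type*} [TopologicalSpace α] (U : Set α) : Type _ :=
  {V : Clopens α // (V : Set α) ⊆ U}

instance {α : Type*} [TopologicalSpace α] (U : Set α) : IsDirectedOrder (ClopensWithin U) :=
  ⟨fun V W => ⟨⟨V.1 ⊔ W.1, union_subset V.2 W.2⟩,
    show V.1 ≤ V.1 ⊔ W.1 from le_sup_left, show W.1 ≤ V.1 ⊔ W.1 from le_sup_right⟩⟩

instance {α : Type*} [TopologicalSpace α] (U : Set α) : Nonempty (ClopensWithin U) :=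
  ⟨⟨⊥, empty_subset U⟩⟩

variable {C : Type u} [CommCStarAlgebra C]
variable {H : Type u} [NormedAddCommGroup H] [InnerProductSpace ℂ H] [CompleteSpace H]
variable {ρ : C →⋆ₐ[ℂ] (H →L[ℂ] H)} {U : Set (characterSpace ℂ C)}

theorem norm_map_clopenProj_apply_le (ρ : C →⋆ₐ[ℂ] (H →L[ℂ] H))
    (V : Clopens (characterSpace ℂ C)) (x : H) : ‖ρ (clopenProj V) x‖ ≤ ‖x‖ :=
  ((ρ (clopenProj V)).le_of_opNorm_le ((isStarProjection_clopenProj V).map ρ).norm_le x).trans_eq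
    (one_mul _)

theorem closedRange_clopenProj_eq_top (hρ : IsVonNeumann ρ) (hU : IsOpen U) (hd : Dense U) :
    closedRange ρ (range fun V : ClopensWithin U => clopenProj V.1) = ⊤ := by
  have := extremallyDisconnected_characterSpace hρ
  obtain ⟨q, hq, hq_mul, -⟩ :=
    exists_supportProjection hρ (range fun V : ClopensWithin U => clopenProj V.1)
  have hq_one : q = 1 := eq_of_forall_character fun t => by
    refine eqOn_closure_of_character_eq (fun s hs => ?_) (hd t)
    obtain ⟨V, hV, hsV, hVU⟩ := compact_exists_isClopen_in_isOpen hU hs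
    have := congrArg s (hq_mul _ (mem_range_self ⟨⟨V, hV⟩, hVU⟩))
    rwa [map_mul, character_clopenProj_of_mem (U := ⟨V, hV⟩) hsV, mul_one,
      ← map_one s] at this
  rw [hq_one, map_one] at hq
  exact eq_top_iff.2 fun x _ => Submodule.starProjection_eq_self_iff.1
    (DFunLike.congr_fun hq x).symm

theorem tendsto_map_clopenProj_apply (hρ : IsVonNeumann ρ) (hU : IsOpen U) (hd : Dense U) (x : H) :
    Tendsto (fun V : ClopensWithin U => ρ (clopenProj V.1) x) atTop (𝓝 x) := by
  let E : Submodule ℂ H :=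
    { carrier := {x | Tendsto (fun V : ClopensWithin U => ρ (clopenProj V.1) x) atTop (𝓝 x)}
      zero_mem' := by simp
      add_mem' := fun hx hy => by simpa using Tendsto.add hx hy
      smul_mem' := fun a x hx => by simpa using Tendsto.const_smul hx a }
  have hE : IsClosed (E : Set H) := by
    refine Equicontinuous.isClosed_setOfPred_tendsto
      (LipschitzWith.uniformEquicontinuous _ 1 fun V => ?_).equicontinuous continuous_id
    refine LipschitzWith.of_dist_le_mul fun x y => ?_
    rw [dist_eq_norm, dist_eq_norm, ← map_sub, NNReal.coe_one, one_mul]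
    exact norm_map_clopenProj_apply_le ρ V.1 _
  have hle : closedRange ρ (range fun V : ClopensWithin U => clopenProj V.1) ≤ E := by
    rw [closedRange_le_iff hE, forall_mem_range]
    intro W x
    refine tendsto_const_nhds.congr' ?_
    filter_upwards [eventually_ge_atTop W] with V hV
    rw [← mul_apply_eq_comp, ← map_mul, mul_comm, clopenProj_mul_of_le hV]
  exact hle ((closedRange_clopenProj_eq_top hρ hU hd).ge trivial)

theorem summable_norm_mul_norm {ι E : Type*} [NormedAddCommGroup E]
    (x y : lp (fun _ : ι => E) 2) : Summable fun n => ‖x n‖ * ‖y n‖ :=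
  lp.summable_mul (p := 2) (q := 2) (by simpa using Real.HolderConjugate.two_two) x y

theorem tendsto_clopenProj_weakStar (hρ : IsVonNeumann ρ) (hU : IsOpen U) (hd : Dense U) :
    Tendsto (fun V : ClopensWithin U => clopenProj V.1) atTop (@nhds C (weakStar ρ) 1) := by
  rw [@nhds_induced _ _ (ultraweak H) ρ 1, tendsto_comap_iff, nhds_iInf, tendsto_iInf]
  intro p
  rw [nhds_induced, tendsto_comap_iff]
  refine tendsto_tsum_of_dominated_convergence (bound := fun n => ‖p.2 n‖ * ‖p.1 n‖)
    (summable_norm_mul_norm p.2 p.1) (fun n => ?_) (Eventually.of_forall fun V n => ?_)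
  · rw [map_one]
    exact tendsto_const_nhds.inner (tendsto_map_clopenProj_apply hρ hU hd (p.1 n))
  · exact (norm_inner_le_norm _ _).trans
      (mul_le_mul_of_nonneg_left (norm_map_clopenProj_apply_le ρ _ _) (norm_nonneg _))

end Normality

/-! ### The essential norm -/

section Essup

variable {Δ : Type*} [TopologicalSpace Δ] {f : Δ → ℝ} {c : ℝ}

theorem eventually_lt_of_essup_lt (hf : BddAbove (range f)) (hc : essup f < c) :
    ∀ᶠ t in residual Δ, f t < c := by
  obtain ⟨M, hM⟩ := hf
  have hne : {c : ℝ | IsMeagre {t | c < f t}}.Nonempty := ⟨M, by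
    rw [mem_ofPred_eq, eq_empty_of_forall_notMem (s := {t | M < f t}) fun t ht =>
      (hM (mem_range_self t)).not_gt ht]
    exact IsMeagre.empty⟩
  obtain ⟨a, ha, hac⟩ := exists_lt_of_csInf_lt hne hc
  filter_upwards [show {t | a < f t}ᶜ ∈ residual Δ from ha] with t ht
  exact (not_lt.1 (show ¬a < f t from ht)).trans_lt hac

variable [BaireSpace Δ]

theorem essup_nonneg (hf : ∀ t, 0 ≤ f t) : 0 ≤ essup f := by
  rcases isEmpty_or_nonempty Δ with h | h
  · rw [essup_of_isEmpty]
  · exact Real.sInf_nonneg fun c hc => essup_lower hf hc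

theorem essup_le (hf : ∀ t, 0 ≤ f t) (hc : 0 ≤ c) (hfc : ∀ᶠ t in residual Δ, f t ≤ c) :
    essup f ≤ c := by
  rcases isEmpty_or_nonempty Δ with h | h
  · rwa [essup_of_isEmpty]
  · refine csInf_le ⟨0, fun a ha => essup_lower hf ha⟩ ?_
    exact mem_of_superset hfc fun t (ht : f t ≤ c) => not_lt.2 ht

theorem exists_nonempty_interior_of_lt_essup (hf : UpperSemicontinuous f)
    (hf0 : ∀ t, 0 ≤ f t) (hc0 : 0 ≤ c) (hc : c < essup f) :
    ∃ r > c, (interior {t | r ≤ f t}).Nonempty := by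
  contrapose! hc
  have hmeagre (r : ℝ) (hr : c < r) : IsMeagre {t | r ≤ f t} :=
    ((hf.isClosed_preimage r).isNowhereDense_iff.2 (hc r hr)).isMeagre
  refine essup_le hf0 hc0 ?_
  have hlt (n : ℕ) : ∀ᶠ t in residual Δ, f t < c + 1 / ((n : ℝ) + 1) := by
    filter_upwards [hmeagre _ (lt_add_of_pos_right c Nat.one_div_pos_of_nat)] with t ht
    exact not_le.1 ht
  filter_upwards [eventually_countable_forall.2 hlt] with t ht
  refine le_of_forall_pos_le_add fun ε hε => ?_
  obtain ⟨n, hn⟩ := exists_nat_one_div_lt hε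
  exact (ht n).le.trans (add_le_add_right hn.le c)

end Essup

section EssNorm

theorem continuous_apply_smul_of_forall_tmul {R M N : Type*} [CommRing R] [AddCommGroup M]
    [Module R M] [AddCommGroup N] [Module R N] {τ : TopologicalSpace R} (f : M ⊗[R] N →+ ℂ)
    (hf : ∀ x y, Continuous[τ, inferInstance] fun c : R => f (c • x ⊗ₜ[R] y)) (w : M ⊗[R] N) :
    Continuous[τ, inferInstance] fun c : R => f (c • w) := by
  induction w with
  | zero => simpa only [smul_zero, map_zero] using continuous_const
  | tmul x y => exact hf x y
  | add v w hv hw =>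
    simp only [smul_add, map_add]
    exact hv.add hw

variable {C : Type u} [CommCStarAlgebra C]
variable {X : Type u} [NormedAddCommGroup X] [NormedSpace ℂ X] [Module C X] [IsScalarTower ℂ C X]
variable {Y : Type u} [NormedAddCommGroup Y] [NormedSpace ℂ Y] [Module C Y] [IsScalarTower ℂ C Y]

/-- The essential supremum over the spectrum of the projective norms of the fibres of `w`. -/
def essNorm (w : X ⊗[C] Y) : ℝ :=
  essup fun t : characterSpace ℂ C => gammaNorm (fiberMap t w)

theorem essNorm_nonneg (w : X ⊗[C] Y) : 0 ≤ essNorm w :=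
  essup_nonneg fun _ => gammaNorm_nonneg _

theorem eventually_gammaNorm_fiberMap_lt {w : X ⊗[C] Y} {r : ℝ} (hr : essNorm w < r) :
    ∀ᶠ t : characterSpace ℂ C in residual _, gammaNorm (fiberMap t w) < r :=
  eventually_lt_of_essup_lt ⟨gammaNorm w, forall_mem_range.2 fun t => gammaNorm_fiberMap_le t w⟩ hr

variable {H : Type u} [NormedAddCommGroup H] [InnerProductSpace ℂ H] [CompleteSpace H]
variable {ρ : C →⋆ₐ[ℂ] (H →L[ℂ] H)}

theorem norm_le_essNorm_of_normal [IsBoundedSMul C X] [IsBoundedSMul C Y]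
    [Module Cᵐᵒᵖ X] [IsCentralScalar C X] [Module Cᵐᵒᵖ Y] [IsCentralScalar C Y]
    (hρ : IsVonNeumann ρ) (hX : IsRepresentable C X) (hY : IsRepresentable C Y)
    (f : X ⊗[C] Y →+ ℂ) (hf : ∀ x y, ‖f (x ⊗ₜ y)‖ ≤ ‖x‖ * ‖y‖)
    (hn : ∀ x y, Continuous[weakStar ρ, inferInstance] fun c : C => f (c • x ⊗ₜ[C] y))
    (w : X ⊗[C] Y) : ‖f w‖ ≤ essNorm w := by
  have := extremallyDisconnected_characterSpace hρ
  refine le_of_forall_gt_imp_ge_of_dense fun r hr => ?_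
  have hr0 : 0 ≤ r := (essNorm_nonneg w).trans hr.le
  let U : Set (characterSpace ℂ C) := {t | gammaNorm (fiberMap t w) < r}
  have hlim : Tendsto (fun V : ClopensWithin U => f (clopenProj V.1 • w)) atTop
      (𝓝 (f ((1 : C) • w))) :=
    (@Continuous.tendsto C ℂ (weakStar ρ) _ _ (continuous_apply_smul_of_forall_tmul f hn w) 1).comp
      (tendsto_clopenProj_weakStar hρ
        ((upperSemicontinuous_gammaNorm_fiberMap w).isOpen_preimage r)
        (dense_of_mem_residual (eventually_gammaNorm_fiberMap_lt hr)))
  rw [one_smul] at hlim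
  refine le_of_tendsto hlim.norm (Eventually.of_forall fun V => ?_)
  calc ‖f (clopenProj V.1 • w)‖ ≤ gammaNorm (clopenProj V.1 • w) :=
        (norm_le_mul_gammaNorm f zero_le_one (by simpa only [one_mul] using hf) _).trans_eq
          (one_mul _)
    _ ≤ r := gammaNorm_le_of_fiberMap_le hX hY hr0 fun t => ?_
  rw [fiberMap_smul]
  by_cases ht : t ∈ V.1
  · rw [character_clopenProj_of_mem ht, one_smul]
    exact le_of_lt (V.2 ht)
  · rw [character_clopenProj_of_notMem ht, zero_smul, gammaNorm_zero]
    exact hr0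

theorem exists_functional_eq_gammaNorm_fiberMap (t : characterSpace ℂ C) (w : X ⊗[C] Y) :
    ∃ F : X ⊗[C] Y →ₛₗ[(t : C →+* ℂ)] ℂ,
      (∀ v, ‖F v‖ ≤ gammaNorm (fiberMap t v)) ∧ F w = gammaNorm (fiberMap t w) := by
  obtain ⟨g, hg, hgw⟩ := exists_dual_vector'' (E := GammaPre ℂ (Fiber t X) (Fiber t Y)) ℂ
    (fiberMap t w)
  exact ⟨g.toLinearMap.comp (fiberMap t), fun v => (g.le_of_opNorm_le hg _).trans_eq (one_mul _),
    hgw⟩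

end EssNorm

section Gluing

/-- This is a section of the limit map of the compact space `Δ`, which exists by projectivity. -/
theorem exists_continuous_ultrafilter_le_nhds (Δ : Type*) [TopologicalSpace Δ] [CompactSpace Δ]
    [T2Space Δ] [ExtremallyDisconnected Δ] :
    ∃ h : Δ → Ultrafilter Δ, Continuous h ∧ ∀ t, (h t : Filter Δ) ≤ 𝓝 t := by
  obtain ⟨h, hc, he⟩ := CompactT2.ExtremallyDisconnected.projective (A := Δ) continuous_id
    (continuous_ultrafilter_extend (id : Δ → Δ))
    (fun t => ⟨pure t, ultrafilter_extend_pure id t⟩)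
  refine ⟨h, hc, fun t => ?_⟩
  simpa only [Ultrafilter.map_id, id_eq] using ultrafilter_extend_eq_iff.1 (congrFun he t)

variable {C : Type u} [CommCStarAlgebra C]
  {h : characterSpace ℂ C → Ultrafilter (characterSpace ℂ C)}

theorem exists_tendsto_character (hc : Continuous h) {k : characterSpace ℂ C → ℂ} {M : ℝ}
    (hk : ∀ t, ‖k t‖ ≤ M) : ∃ c : C, ∀ t : characterSpace ℂ C, Tendsto k (h t) (𝓝 (t c)) := by
  let k' : characterSpace ℂ C → Metric.closedBall (0 : ℂ) M :=
    fun t => ⟨k t, mem_closedBall_zero_iff.2 (hk t)⟩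
  let K : C(characterSpace ℂ C, ℂ) := ⟨fun t => (Ultrafilter.extend k' (h t)).1,
    continuous_subtype_val.comp ((continuous_ultrafilter_extend k').comp hc)⟩
  refine ⟨(gelfandStarTransform C).symm K, fun t => ?_⟩
  rw [character_gelfandStarTransform_symm]
  exact (continuous_subtype_val.tendsto _).comp
    (ultrafilter_extend_eq_iff.1 (rfl : Ultrafilter.extend k' (h t) = _))

theorem exists_linearMap_tendsto (hc : Continuous h) (hh : ∀ t, (h t : Filter _) ≤ 𝓝 t)
    {M : Type*} [AddCommGroup M] [Module C M]
    (F : ∀ t : characterSpace ℂ C, M →ₛₗ[(t : C →+* ℂ)] ℂ)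
    (hF : ∀ m, ∃ B, ∀ t, ‖F t m‖ ≤ B) :
    ∃ Θ : M →ₗ[C] C, ∀ (t : characterSpace ℂ C) m,
      Tendsto (fun s => F s m) (h t) (𝓝 (t (Θ m))) := by
  choose B hB using hF
  choose Θ hΘ using fun m => exists_tendsto_character hc (hB m)
  refine ⟨⟨⟨Θ, fun m n => ?_⟩, fun c m => ?_⟩, fun t m => hΘ m t⟩
  · refine eq_of_forall_character fun t => tendsto_nhds_unique (hΘ _ t) ?_
    simpa only [map_add] using (hΘ m t).add (hΘ n t)
  · refine eq_of_forall_character fun t => tendsto_nhds_unique (hΘ _ t) ?_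
    simp only [map_smulₛₗ, RingHom.id_apply, smul_eq_mul, map_mul]
    exact (((continuous_character c).tendsto t).mono_left (hh t)).mul (hΘ m t)

variable {X : Type u} [NormedAddCommGroup X] [NormedSpace ℂ X] [Module C X] [IsScalarTower ℂ C X]
  [IsBoundedSMul C X]
variable {Y : Type u} [NormedAddCommGroup Y] [NormedSpace ℂ Y] [Module C Y] [IsScalarTower ℂ C Y]
  [IsBoundedSMul C Y]

theorem essNorm_le_of_forall [ExtremallyDisconnected (characterSpace ℂ C)] (w : X ⊗[C] Y) {b : ℝ}
    (hb : ∀ θ : X →ₗ[C] Y →ₗ[C] C, (∀ x y, ‖θ x y‖ ≤ ‖x‖ * ‖y‖) →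
      ‖TensorProduct.lift θ w‖ ≤ b) : essNorm w ≤ b := by
  have hb0 : 0 ≤ b := (norm_nonneg _).trans (hb 0 fun x y => by
    simpa only [LinearMap.zero_apply, norm_zero] using by positivity)
  by_contra! hlt
  obtain ⟨r, hr, t₀, ht₀⟩ :=
    exists_nonempty_interior_of_lt_essup (upperSemicontinuous_gammaNorm_fiberMap w)
      (fun t => gammaNorm_nonneg _) hb0 hlt
  obtain ⟨h, hc, hh⟩ := exists_continuous_ultrafilter_le_nhds (characterSpace ℂ C)
  choose F hF hFw using fun t => exists_functional_eq_gammaNorm_fiberMap t w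
  obtain ⟨Θ, hΘ⟩ := exists_linearMap_tendsto hc hh F
    fun v => ⟨gammaNorm v, fun t => (hF t v).trans (gammaNorm_fiberMap_le t v)⟩
  have hΘ_tmul : ∀ x y, ‖Θ (x ⊗ₜ y)‖ ≤ ‖x‖ * ‖y‖ := fun x y =>
    norm_le_of_forall_character (by positivity) fun t => le_of_tendsto (hΘ t (x ⊗ₜ y)).norm <|
      Eventually.of_forall fun s =>
        (hF s _).trans ((gammaNorm_fiberMap_le s _).trans (gammaNorm_tmul_le x y))
  have hΘw : ‖Θ w‖ ≤ b := by
    simpa only [TensorProduct.lift_mk_compr₂] using hb ((TensorProduct.mk C X Y).compr₂ Θ) hΘ_tmul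
  have hr_le : r ≤ ‖t₀ (Θ w)‖ := by
    refine ge_of_tendsto (hΘ t₀ w).norm ?_
    filter_upwards [hh t₀ (mem_interior_iff_mem_nhds.1 ht₀)] with s hs
    rw [hFw, Complex.norm_of_nonneg (gammaNorm_nonneg _)]
    exact hs
  exact (hr.trans_le hr_le).not_ge ((NonUnitalStarAlgHom.norm_apply_le t₀ _).trans hΘw)

end Gluing

/-! ### The norm `ν_C` is the essential norm -/

section Ultraweak

variable {H : Type u} [NormedAddCommGroup H] [InnerProductSpace ℂ H]

theorem continuous_tsum_inner_nat {x y : ℕ → H} (hx : Summable fun n => ‖x n‖ ^ 2)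
    (hy : Summable fun n => ‖y n‖ ^ 2) :
    Continuous[ultraweak H, inferInstance] fun T : H →L[ℂ] H => ∑' n, ⟪y n, T (x n)⟫_ℂ := by
  have mem {x : ℕ → H} (hx : Summable fun n => ‖x n‖ ^ 2) : Memℓp x 2 :=
    memℓp_gen (by simpa using hx)
  exact continuous_iInf_dom (i := ((⟨x, mem hx⟩, ⟨y, mem hy⟩) :
    lp (fun _ : ℕ => H) 2 × lp (fun _ : ℕ => H) 2)) continuous_induced_dom

theorem continuous_tsum_inner {ι : Type*} {x y : ι → H} (hx : Summable fun n => ‖x n‖ ^ 2)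
    (hy : Summable fun n => ‖y n‖ ^ 2) :
    Continuous[ultraweak H, inferInstance] fun T : H →L[ℂ] H => ∑' n, ⟪y n, T (x n)⟫_ℂ := by
  let S := Function.support fun n => ‖x n‖ ^ 2
  have : Countable S := hx.countable_support
  obtain ⟨e, he⟩ := exists_injective_nat S
  let z : ℕ → H × H := Function.extend e (fun k : S => (x k, y k)) 0
  have hz {G : Type} [Zero G] (g : H × H → G) (hg : g 0 = 0) :
      (fun n => g (z n)) = Function.extend e (fun k : S => g (x k, y k)) 0 := funext fun n => by
    refine (Function.apply_extend g ..).trans ?_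
    rw [show g ∘ (0 : ℕ → H × H) = 0 from funext fun _ => hg]
    rfl
  convert! continuous_tsum_inner_nat (x := fun n => (z n).1) (y := fun n => (z n).2) ?_ ?_
    using 2 with T
  · rw [hz (fun p => ⟪p.2, T p.1⟫_ℂ) (by simp), tsum_extend_zero he,
      tsum_subtype_eq_of_support_subset (f := fun k => ⟪y k, T (x k)⟫_ℂ)]
    intro n hn
    contrapose! hn
    have hxn : x n = 0 := by simpa [S] using hn
    simp [hxn]
  · rw [hz (fun p => ‖p.1‖ ^ 2) (by simp)]
    exact (summable_extend_zero he).2 (hx.subtype S)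
  · rw [hz (fun p => ‖p.2‖ ^ 2) (by simp)]
    exact (summable_extend_zero he).2 (hy.subtype S)

theorem continuous_inner_ultraweak (ξ η : H) :
    Continuous[ultraweak H, inferInstance] fun T : H →L[ℂ] H => ⟪η, T ξ⟫_ℂ := by
  simpa only [tsum_const, Nat.card_unique, one_smul] using
    continuous_tsum_inner (ι := Unit) (x := fun _ => ξ) (y := fun _ => η)
      (hasSum_fintype _).summable (hasSum_fintype _).summable

end Ultraweak

section NuNorm

variable {C : Type u} [CommCStarAlgebra C]
variable {H : Type u} [NormedAddCommGroup H] [InnerProductSpace ℂ H] [CompleteSpace H]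
variable {ρ : C →⋆ₐ[ℂ] (H →L[ℂ] H)}

theorem isNormalRepresentable_self (hρ : Function.Injective ρ) : IsNormalRepresentable ρ C := by
  let J : C →ₗᵢ[ℂ] (H →L[ℂ] H) :=
    ⟨ρ.toAlgHom.toLinearMap, fun c => NonUnitalStarAlgHom.norm_map ρ hρ c⟩
  exact ⟨H, _, _, inferInstance, H, _, _, inferInstance, ρ, ρ, J, continuous_induced_dom,
    continuous_induced_dom, fun c v => map_mul ρ c v, fun c v => map_mul ρ v c⟩

section Bounded

variable {X Y : Type u} [NormedAddCommGroup X] [NormedSpace ℂ X] [Module C X] [IsScalarTower ℂ C X]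
  [Module Cᵐᵒᵖ X] [NormedAddCommGroup Y] [NormedSpace ℂ Y] [Module C Y] [IsScalarTower ℂ C Y]
  [Module Cᵐᵒᵖ Y]

theorem norm_lift_le_mul_nuNorm {V : Type u} [NormedAddCommGroup V] [NormedSpace ℂ V]
    [CompleteSpace V] [Module C V] [Module Cᵐᵒᵖ V] (hV : IsNormalRepresentable ρ V)
    {φ : X →ₗ[C] Y →ₗ[C] V} (hφ_op : ∀ (c : C) x y, φ x (op c • y) = op c • φ x y) {A : ℝ}
    (hA : 0 ≤ A) (hφ : ∀ x y, ‖φ x y‖ ≤ A * (‖x‖ * ‖y‖)) (w : X ⊗[C] Y) :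
    ‖TensorProduct.lift φ w‖ ≤ A * nuNorm ρ w := by
  have := hV.isRepresentable.isScalarTower
  rcases hA.eq_or_lt with rfl | hA
  · have : TensorProduct.lift φ = 0 :=
      TensorProduct.ext' fun x y => norm_le_zero_iff.1 (by simpa using hφ x y)
    simp [this]
  let z : ℂ := (A⁻¹ : ℝ)
  have hz : ‖z‖ = A⁻¹ := by
    rw [Complex.norm_real, Real.norm_of_nonneg (inv_nonneg.2 hA.le)]
  have hmem : ‖TensorProduct.lift (φ ∘ₗ LinearMap.lsmul C X (algebraMap ℂ C z)) w‖ ∈ nuSet ρ w := by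
    refine ⟨V, inferInstance, inferInstance, inferInstance, inferInstance, inferInstance,
      φ ∘ₗ LinearMap.lsmul C X (algebraMap ℂ C z), hV, fun c x y => hφ_op c _ y,
      fun x y => (hφ _ y).trans_eq ?_, rfl⟩
    rw [LinearMap.lsmul_apply, algebraMap_smul, norm_smul, hz]
    field_simp
  have hlift : TensorProduct.lift (φ ∘ₗ LinearMap.lsmul C X (algebraMap ℂ C z)) w =
      z • TensorProduct.lift φ w := by
    rw [← algebraMap_smul C z, ← LinearMap.smul_apply]
    congr 1
    ext x y
    simp
  rw [← inv_mul_le_iff₀ hA, ← hz, ← norm_smul, ← hlift]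
  exact le_csSup (nuSet_bddAbove ρ w) hmem

end Bounded

section NuSet

variable {X Y : Type u} [NormedAddCommGroup X] [Module C X] [NormedAddCommGroup Y] [Module C Y]
  [Module Cᵐᵒᵖ Y] [IsCentralScalar C Y]

theorem norm_lift_mem_nuSet (hρ : Function.Injective ρ) {θ : X →ₗ[C] Y →ₗ[C] C}
    (hθ : ∀ x y, ‖θ x y‖ ≤ ‖x‖ * ‖y‖) (w : X ⊗[C] Y) : ‖TensorProduct.lift θ w‖ ∈ nuSet ρ w := by
  refine ⟨C, inferInstance, inferInstance, inferInstance, inferInstance, inferInstance, θ,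
    isNormalRepresentable_self hρ, fun c x y => ?_, hθ, rfl⟩
  rw [op_smul_eq_smul, op_smul_eq_smul, map_smul]

theorem nuSet_nonempty (hρ : Function.Injective ρ) (w : X ⊗[C] Y) : (nuSet ρ w).Nonempty :=
  ⟨_, norm_lift_mem_nuSet hρ (θ := 0)
    (fun x y => by simpa only [LinearMap.zero_apply, norm_zero] using by positivity) w⟩

variable [NormedSpace ℂ X] [IsScalarTower ℂ C X] [NormedSpace ℂ Y] [IsScalarTower ℂ C Y]
  [Module Cᵐᵒᵖ X]

theorem norm_lift_le_nuNorm (hρ : Function.Injective ρ) {θ : X →ₗ[C] Y →ₗ[C] C}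
    (hθ : ∀ x y, ‖θ x y‖ ≤ ‖x‖ * ‖y‖) (w : X ⊗[C] Y) :
    ‖TensorProduct.lift θ w‖ ≤ nuNorm ρ w :=
  le_csSup (nuSet_bddAbove ρ w) (norm_lift_mem_nuSet hρ hθ w)

end NuSet

variable {X : Type u} [NormedAddCommGroup X] [NormedSpace ℂ X] [Module C X]
  [Module Cᵐᵒᵖ X] [IsCentralScalar C X]
variable {Y : Type u} [NormedAddCommGroup Y] [NormedSpace ℂ Y] [Module C Y]

/-- The functionals defining `ν_C` in the third formula: `C`-balanced bilinear contractions which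
are weak* continuous in the variable from `C`. -/
structure IsNormalContraction (ρ : C →⋆ₐ[ℂ] (H →L[ℂ] H)) (θ : X →ₗ[ℂ] Y →ₗ[ℂ] ℂ) : Prop where
  norm_le (x : X) (y : Y) : ‖θ x y‖ ≤ ‖x‖ * ‖y‖
  balanced (c : C) (x : X) (y : Y) : θ (op c • x) y = θ x (c • y)
  continuous (x : X) (y : Y) : Continuous[weakStar ρ, inferInstance] fun c : C => θ x (c • y)

variable [IsScalarTower ℂ C X] [IsScalarTower ℂ C Y]

theorem isNormalContraction_inner {V K L : Type u} [NormedAddCommGroup V] [NormedSpace ℂ V]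
    [Module C V] [IsScalarTower ℂ C V] [NormedAddCommGroup K] [InnerProductSpace ℂ K]
    [CompleteSpace K] [NormedAddCommGroup L] [InnerProductSpace ℂ L] {π : C →⋆ₐ[ℂ] (K →L[ℂ] K)}
    (hπ : IsNormalRep ρ π) {J : V →ₗᵢ[ℂ] (L →L[ℂ] K)} (hJ : ∀ c v, J (c • v) = (π c).comp (J v))
    {φ : X →ₗ[C] Y →ₗ[C] V} (hφ : ∀ x y, ‖φ x y‖ ≤ ‖x‖ * ‖y‖) {ξ : L} {η : K} (hξ : ‖ξ‖ = 1)
    (hη : ‖η‖ = 1) :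
    IsNormalContraction ρ ((φ.restrictScalars₁₂ ℂ ℂ).compr₂ ((innerSL ℂ η).toLinearMap ∘ₗ
      (ContinuousLinearMap.apply ℂ K ξ).toLinearMap ∘ₗ J.toLinearMap)) where
  norm_le x y := by
    calc ‖⟪η, J (φ x y) ξ⟫_ℂ‖ ≤ ‖η‖ * ‖J (φ x y) ξ‖ := norm_inner_le_norm _ _
      _ ≤ ‖η‖ * (‖x‖ * ‖y‖ * ‖ξ‖) := by
          gcongr
          exact (J _).le_of_opNorm_le ((J.norm_map _).trans_le (hφ x y)) ξ
      _ = ‖x‖ * ‖y‖ := by rw [hξ, hη, one_mul, mul_one]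
  balanced c x y := by
    change ⟪η, J (φ (op c • x) y) ξ⟫_ℂ = ⟪η, J (φ x (c • y)) ξ⟫_ℂ
    rw [op_smul_eq_smul, map_smul, map_smul, LinearMap.smul_apply]
  continuous x y := by
    have hcont := @Continuous.comp _ _ _ (weakStar ρ) (ultraweak K) _ _ _
      (continuous_inner_ultraweak (J (φ x y) ξ) η) hπ
    refine (@continuous_congr _ _ (weakStar ρ) _ _ _ fun c => ?_).2 hcont
    change ⟪η, J (φ x (c • y)) ξ⟫_ℂ = ⟪η, π c (J (φ x y) ξ)⟫_ℂ
    rw [map_smul, hJ]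
    rfl

theorem norm_sum_le_of_forall_isNormalContraction {V : Type u} [NormedAddCommGroup V]
    [NormedSpace ℂ V] [Module C V] [Module Cᵐᵒᵖ V] (hV : IsNormalRepresentable ρ V)
    {φ : X →ₗ[C] Y →ₗ[C] V} (hφ : ∀ x y, ‖φ x y‖ ≤ ‖x‖ * ‖y‖) {n : ℕ} {x : Fin n → X}
    {y : Fin n → Y} {b : ℝ} (hb : ∀ θ, IsNormalContraction ρ θ → ‖∑ j, θ (x j) (y j)‖ ≤ b) :
    ‖∑ j, φ (x j) (y j)‖ ≤ b := by
  have := hV.isRepresentable.isScalarTower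
  obtain ⟨K, _, _, _, L, _, _, _, π, σ, J, hπ, -, hJ, -⟩ := hV
  have hb0 : 0 ≤ b := (norm_nonneg _).trans (hb 0
    { norm_le x y := by simpa only [LinearMap.zero_apply, norm_zero] using by positivity
      balanced c x y := rfl
      continuous _ _ := @continuous_const _ _ (weakStar ρ) _ _ })
  rw [← J.norm_map]
  refine ContinuousLinearMap.opNorm_le_of_re_inner_le hb0 fun ξ η hξ hη => ?_
  refine (Complex.re_le_norm _).trans ?_
  rw [norm_inner_symm, map_sum, sum_apply, inner_sum]
  exact hb _ (isNormalContraction_inner hπ hJ hφ hξ hη)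

variable [Module Cᵐᵒᵖ Y] [IsCentralScalar C Y]

theorem nuNorm_le_of_forall_isNormalContraction (hρ : Function.Injective ρ) {n : ℕ}
    {x : Fin n → X} {y : Fin n → Y} {b : ℝ}
    (hb : ∀ θ, IsNormalContraction ρ θ → ‖∑ j, θ (x j) (y j)‖ ≤ b) :
    nuNorm ρ (∑ j, x j ⊗ₜ[C] y j) ≤ b := by
  refine csSup_le (nuSet_nonempty hρ _) ?_
  rintro r ⟨V, _, _, _, _, _, φ, hV, -, hφ, rfl⟩
  simpa only [map_sum, TensorProduct.lift.tmul] using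
    norm_sum_le_of_forall_isNormalContraction hV hφ hb

variable [IsBoundedSMul C X] [IsBoundedSMul C Y]

theorem IsNormalContraction.norm_sum_le_essNorm (hρ : IsVonNeumann ρ) (hX : IsRepresentable C X)
    (hY : IsRepresentable C Y) {θ : X →ₗ[ℂ] Y →ₗ[ℂ] ℂ} (hθ : IsNormalContraction ρ θ)
    {n : ℕ} (x : Fin n → X) (y : Fin n → Y) :
    ‖∑ j, θ (x j) (y j)‖ ≤ essNorm (∑ j, x j ⊗ₜ[C] y j) := by
  have hbal (c : C) (x : X) (y : Y) : θ (c • x) y = θ x (c • y) := by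
    rw [← op_smul_eq_smul, hθ.balanced]
  let f : X ⊗[C] Y →+ ℂ := TensorProduct.liftAddHom
    (LinearMap.toAddMonoidHom'.comp θ.toAddMonoidHom) hbal
  have hf (x : X) (y : Y) : f (x ⊗ₜ y) = θ x y := rfl
  simpa only [map_sum, hf] using norm_le_essNorm_of_normal hρ hX hY f hθ.norm_le
    (fun x y => by simpa only [TensorProduct.smul_tmul', hf, hbal] using hθ.continuous x y)
    (∑ j, x j ⊗ₜ[C] y j)

theorem nuNorm_eq_essNorm (hρ : IsVonNeumann ρ) (hX : IsRepresentable C X)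
    (hY : IsRepresentable C Y) (w : X ⊗[C] Y) : nuNorm ρ w = essNorm w := by
  have := extremallyDisconnected_characterSpace hρ
  refine le_antisymm ?_ (essNorm_le_of_forall w fun θ hθ => norm_lift_le_nuNorm hρ.1 hθ w)
  obtain ⟨n, x, y, rfl⟩ := exists_rep w
  exact nuNorm_le_of_forall_isNormalContraction hρ.1 fun θ hθ =>
    hθ.norm_sum_le_essNorm hρ hX hY x y

theorem isLUB_nuNorm_module (hρ : IsVonNeumann ρ) (hX : IsRepresentable C X)
    (hY : IsRepresentable C Y) {n : ℕ} (x : Fin n → X) (y : Fin n → Y) :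
    IsLUB {r : ℝ | ∃ θ : X →ₗ[C] Y →ₗ[C] C, (∀ a b, ‖θ a b‖ ≤ ‖a‖ * ‖b‖) ∧
        r = ‖∑ j, θ (x j) (y j)‖} (nuNorm ρ (∑ j, x j ⊗ₜ[C] y j)) := by
  have := extremallyDisconnected_characterSpace hρ
  have hlift (θ : X →ₗ[C] Y →ₗ[C] C) :
      TensorProduct.lift θ (∑ j, x j ⊗ₜ[C] y j) = ∑ j, θ (x j) (y j) := by
    simp only [map_sum, TensorProduct.lift.tmul]
  constructor
  · rintro r ⟨θ, hθ, rfl⟩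
    exact hlift θ ▸ norm_lift_le_nuNorm hρ.1 hθ _
  · intro b hb
    rw [nuNorm_eq_essNorm hρ hX hY]
    exact essNorm_le_of_forall _ fun θ hθ => hb ⟨θ, hθ, by rw [hlift]⟩

theorem isLUB_nuNorm_normal (hρ : IsVonNeumann ρ) (hX : IsRepresentable C X)
    (hY : IsRepresentable C Y) {n : ℕ} (x : Fin n → X) (y : Fin n → Y) :
    IsLUB {r : ℝ | ∃ θ : X →ₗ[ℂ] Y →ₗ[ℂ] ℂ, (∀ a b, ‖θ a b‖ ≤ ‖a‖ * ‖b‖) ∧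
          (∀ (c : C) a b, θ (op c • a) b = θ a (c • b)) ∧
          (∀ a b, Continuous[weakStar ρ, inferInstance] fun c : C => θ a (c • b)) ∧
          r = ‖∑ j, θ (x j) (y j)‖}
        (nuNorm ρ (∑ j, x j ⊗ₜ[C] y j)) := by
  constructor
  · rintro r ⟨θ, hθ, hθ_bal, hθ_cont, rfl⟩
    rw [nuNorm_eq_essNorm hρ hX hY]
    exact IsNormalContraction.norm_sum_le_essNorm hρ hX hY ⟨hθ, hθ_bal, hθ_cont⟩ x y
  · intro b hb
    exact nuNorm_le_of_forall_isNormalContraction hρ.1 fun θ hθ =>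
      hb ⟨θ, hθ.norm_le, hθ.balanced, hθ.continuous, rfl⟩

end NuNorm

/-! ### Representability of the tensor products -/

theorem norm_le_norm_mapCLM {I 𝕜 : Type*} [NontriviallyNormedField 𝕜] {E F : I → Type*}
    [∀ i, NormedAddCommGroup (E i)] [∀ i, NormedSpace 𝕜 (E i)] [∀ i, NormedAddCommGroup (F i)]
    [∀ i, NormedSpace 𝕜 (F i)] {p : ℝ≥0∞} [Fact (1 ≤ p)] (T : ∀ i, E i →L[𝕜] F i) {b : ℝ}
    (hb : 0 ≤ b) (hT : ∀ i, ‖T i‖ ≤ b) (i : I) : ‖T i‖ ≤ ‖lp.mapCLM p T hb hT‖ := by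
  classical
  have hp : 0 < p := zero_lt_one.trans_le Fact.out
  refine ContinuousLinearMap.opNorm_le_bound _ (norm_nonneg _) fun ξ => ?_
  calc ‖T i ξ‖ = ‖lp.mapCLM p T hb hT (lp.single p i ξ) i‖ := by
        rw [lp.mapCLM_apply_coe, lp.single_apply_self]
    _ ≤ ‖lp.mapCLM p T hb hT (lp.single p i ξ)‖ := lp.norm_apply_le_norm hp.ne' _ i
    _ ≤ ‖lp.mapCLM p T hb hT‖ * ‖ξ‖ := by
        rw [← lp.norm_single (E := E) (p := p) hp i ξ]
        exact ContinuousLinearMap.le_opNorm _ _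

section SquareSummable

variable {I E : Type*} [NormedAddCommGroup E]

theorem summable_norm_sq_coe (x : lp (fun _ : I => E) 2) : Summable fun i => ‖x i‖ ^ 2 := by
  simpa using (lp.memℓp x).summable (by norm_num)

theorem tsum_norm_sq_coe (x : lp (fun _ : I => E) 2) : ∑' i, ‖x i‖ ^ 2 = ‖x‖ ^ 2 := by
  simpa using (lp.norm_rpow_eq_tsum (p := 2) (by norm_num) x).symm

theorem summable_norm_sq_uncurry {x : ℕ → lp (fun _ : I => E) 2}
    (hx : Summable fun n => ‖x n‖ ^ 2) : Summable fun k : ℕ × I => ‖x k.1 k.2‖ ^ 2 := by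
  rw [summable_prod_of_nonneg fun k => by positivity]
  exact ⟨fun n => summable_norm_sq_coe (x n), by simpa only [tsum_norm_sq_coe] using hx⟩

theorem summable_inner_apply [InnerProductSpace ℂ E] {x y : I → E}
    (hx : Summable fun k => ‖x k‖ ^ 2) (hy : Summable fun k => ‖y k‖ ^ 2) (T : E →L[ℂ] E) :
    Summable fun k => ⟪y k, T (x k)⟫_ℂ := by
  refine .of_norm_bounded ((hy.add hx).mul_left ‖T‖) fun k => ?_
  calc ‖⟪y k, T (x k)⟫_ℂ‖ ≤ ‖y k‖ * (‖T‖ * ‖x k‖) :=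
        (norm_inner_le_norm _ _).trans (by gcongr; exact T.le_opNorm _)
    _ = ‖T‖ * (‖y k‖ * ‖x k‖) := mul_left_comm ..
    _ ≤ ‖T‖ * (‖y k‖ ^ 2 + ‖x k‖ ^ 2) := by
        gcongr
        nlinarith [two_mul_le_add_sq ‖y k‖ ‖x k‖, norm_nonneg (y k), norm_nonneg (x k)]

end SquareSummable

section Diagonal

variable {C : Type u} [CommCStarAlgebra C]
variable {I : Type u} {E : Type*} [NormedAddCommGroup E] [InnerProductSpace ℂ E] [CompleteSpace E]

/-- The Hilbert space direct sum of a family of representations on one Hilbert space. -/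
def diagRep (π : I → C →⋆ₐ[ℂ] (E →L[ℂ] E)) :
    C →⋆ₐ[ℂ] (lp (fun _ : I => E) 2 →L[ℂ] lp (fun _ : I => E) 2) where
  toFun c := lp.mapCLM 2 (fun i => π i c) (norm_nonneg c)
    fun i => NonUnitalStarAlgHom.norm_apply_le (π i) c
  map_one' := by ext x i; simp
  map_mul' a b := by ext x i; simp
  map_zero' := by ext x i; simp
  map_add' a b := by ext x i; simp
  commutes' z := by
    ext x i
    simp [Algebra.algebraMap_eq_smul_one]
  map_star' c := by
    rw [ContinuousLinearMap.star_eq_adjoint, ContinuousLinearMap.eq_adjoint_iff]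
    intro x y
    rw [lp.inner_eq_tsum, lp.inner_eq_tsum]
    refine tsum_congr fun i => ?_
    change ⟪π i (star c) (x i), y i⟫_ℂ = ⟪x i, π i c (y i)⟫_ℂ
    rw [map_star, ContinuousLinearMap.star_eq_adjoint, ContinuousLinearMap.adjoint_inner_left]

/-- The block diagonal embedding given by a norming family of contractive operator valued maps. -/
def diagEmb {V : Type*} [SeminormedAddCommGroup V] [NormedSpace ℂ V]
    (f : I → V →ₗ[ℂ] (E →L[ℂ] E)) (hf : ∀ i v, ‖f i v‖ ≤ ‖v‖)
    (hn : ∀ v b, 0 ≤ b → (∀ i, ‖f i v‖ ≤ b) → ‖v‖ ≤ b) :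
    V →ₗᵢ[ℂ] (lp (fun _ : I => E) 2 →L[ℂ] lp (fun _ : I => E) 2) where
  toFun v := lp.mapCLM 2 (fun i => f i v) (norm_nonneg v) fun i => hf i v
  map_add' v w := by ext x i; simp
  map_smul' z v := by ext x i; simp
  norm_map' v := le_antisymm (lp.norm_mapCLM_le 2 _ (norm_nonneg v) fun i => hf i v)
    (hn v _ (norm_nonneg _) (norm_le_norm_mapCLM _ (norm_nonneg v) fun i => hf i v))

theorem isNormalRep_diagRep {H : Type u} [NormedAddCommGroup H] [InnerProductSpace ℂ H]
    [CompleteSpace H] (ρ : C →⋆ₐ[ℂ] (H →L[ℂ] H)) :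
    IsNormalRep ρ (diagRep fun _ : I => ρ) := by
  refine continuous_iInf_rng.2 fun p => continuous_induced_rng.2 ?_
  have hx := summable_norm_sq_uncurry (summable_norm_sq_coe p.1)
  have hy := summable_norm_sq_uncurry (summable_norm_sq_coe p.2)
  have huncurry : (fun c => ∑' n, ⟪p.2 n, diagRep (fun _ : I => ρ) c (p.1 n)⟫_ℂ) =
      fun c => ∑' k : ℕ × I, ⟪p.2 k.1 k.2, ρ c (p.1 k.1 k.2)⟫_ℂ := by
    ext c
    rw [(summable_inner_apply hx hy (ρ c)).tsum_prod]
    exact tsum_congr fun n => lp.inner_eq_tsum _ _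
  change Continuous[weakStar ρ, _] fun c => ∑' n, ⟪p.2 n, diagRep (fun _ : I => ρ) c (p.1 n)⟫_ℂ
  rw [huncurry]
  exact @Continuous.comp _ _ _ (weakStar ρ) (ultraweak H) _ _ _
    (continuous_tsum_inner hx hy) continuous_induced_dom

end Diagonal

section Extension

variable {V : Type*} [SeminormedAddCommGroup V] [NormedSpace ℂ V]
variable {W : Type*} [NormedAddCommGroup W] [NormedSpace ℂ W] [CompleteSpace W]

theorem exists_extension_completion (f : V →ₗ[ℂ] W) {M : ℝ} (hM : 0 ≤ M)
    (hf : ∀ v, ‖f v‖ ≤ M * ‖v‖) :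
    ∃ F : Completion V →L[ℂ] W, (∀ v : V, F v = f v) ∧ ‖F‖ ≤ M := by
  let F := (f.mkContinuous M hf).extend (Completion.toComplL : V →L[ℂ] Completion V)
  have hF (v : V) : F v = f v := ContinuousLinearMap.extend_eq (f.mkContinuous M hf)
    Completion.denseRange_coe (Completion.isUniformInducing_coe V) v
  refine ⟨F, hF, ContinuousLinearMap.opNorm_le_bound _ hM fun v => ?_⟩
  refine Completion.induction_on v (isClosed_le (by fun_prop) (by fun_prop)) fun v => ?_
  rw [hF, Completion.norm_coe]
  exact hf v

theorem exists_isometry_completion (f : V →ₗᵢ[ℂ] W) :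
    ∃ F : Completion V →ₗᵢ[ℂ] W, ∀ v : V, F v = f v := by
  obtain ⟨F, hF, -⟩ := exists_extension_completion f.toLinearMap zero_le_one
    fun v => by rw [one_mul]; exact (f.norm_map v).le
  refine ⟨⟨F.toLinearMap, fun v => ?_⟩, hF⟩
  refine Completion.induction_on v (isClosed_eq F.continuous.norm (by fun_prop)) fun v => ?_
  rw [Completion.norm_coe, ← f.norm_map v]
  exact congrArg norm (hF v)

variable {C : Type u} [CommCStarAlgebra C]
variable {K : Type*} [NormedAddCommGroup K] [InnerProductSpace ℂ K] [CompleteSpace K]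

theorem exists_rep_completion [Module C V] [IsBoundedSMul C V]
    (π : C →⋆ₐ[ℂ] (K →L[ℂ] K)) (J₀ : V →ₗᵢ[ℂ] (K →L[ℂ] K))
    (hl : ∀ (c : C) v, J₀ (c • v) = (π c).comp (J₀ v))
    (hr : ∀ (c : C) v, J₀ (c • v) = (J₀ v).comp (π c)) :
    ∃ J : Completion V →ₗᵢ[ℂ] (K →L[ℂ] K),
      (∀ (c : C) v, J (c • v) = (π c).comp (J v)) ∧
      (∀ (c : C) v, J (c • v) = (J v).comp (π c)) := by
  obtain ⟨J, hJ⟩ := exists_isometry_completion J₀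
  have hsmul (c : C) : Continuous fun v => J (c • v) :=
    J.continuous.comp (continuous_const_smul c)
  refine ⟨J, fun c v => ?_, fun c v => ?_⟩
  · refine Completion.induction_on v (isClosed_eq (hsmul c)
      ((ContinuousLinearMap.compL ℂ K K K (π c)).continuous.comp J.continuous)) fun v => ?_
    rw [← Completion.coe_smul, hJ, hJ, hl]
  · refine Completion.induction_on v (isClosed_eq (hsmul c)
      (((ContinuousLinearMap.compL ℂ K K K).flip (π c)).continuous.comp J.continuous)) fun v => ?_
    rw [← Completion.coe_smul, hJ, hJ, hr]

theorem exists_rep_completion_of_family [Module C V] [IsBoundedSMul C V] {I : Type u}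
    (π : I → C →⋆ₐ[ℂ] (K →L[ℂ] K)) (f : I → V →ₗ[ℂ] (K →L[ℂ] K)) (hf : ∀ i v, ‖f i v‖ ≤ ‖v‖)
    (hn : ∀ v b, 0 ≤ b → (∀ i, ‖f i v‖ ≤ b) → ‖v‖ ≤ b)
    (hl : ∀ i (c : C) v, f i (c • v) = π i c * f i v)
    (hr : ∀ i (c : C) v, f i (c • v) = f i v * π i c) :
    ∃ J : Completion V →ₗᵢ[ℂ] (lp (fun _ : I => K) 2 →L[ℂ] lp (fun _ : I => K) 2),
      (∀ (c : C) v, J (c • v) = (diagRep π c).comp (J v)) ∧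
      (∀ (c : C) v, J (c • v) = (J v).comp (diagRep π c)) :=
  exists_rep_completion (diagRep π) (diagEmb f hf hn)
    (fun c v => ContinuousLinearMap.ext fun x => lp.ext <| funext fun i =>
      DFunLike.congr_fun (hl i c v) (x i))
    (fun c v => ContinuousLinearMap.ext fun x => lp.ext <| funext fun i =>
      DFunLike.congr_fun (hr i c v) (x i))

end Extension

section TensorProducts

variable {C : Type u} [CommCStarAlgebra C]

/-- A character as a one-dimensional representation. -/
def characterRep (t : characterSpace ℂ C) : C →⋆ₐ[ℂ] (ℂ →L[ℂ] ℂ) :=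
  (StarAlgHom.ofId ℂ (ℂ →L[ℂ] ℂ)).comp (t : C →⋆ₐ[ℂ] ℂ)

theorem map_complex_smul {t : characterSpace ℂ C} {M : Type*} [AddCommGroup M] [Module ℂ M]
    [Module C M] [IsScalarTower ℂ C M] (F : M →ₛₗ[(t : C →+* ℂ)] ℂ) (z : ℂ) (m : M) :
    F (z • m) = z * F m := by
  rw [← algebraMap_smul C z m, map_smulₛₗ, smul_eq_mul, RingHom.coe_coe, AlgHomClass.commutes]
  rfl

variable {X : Type u} [NormedAddCommGroup X] [NormedSpace ℂ X] [Module C X] [IsScalarTower ℂ C X]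
  [IsBoundedSMul C X] [Module Cᵐᵒᵖ X] [IsCentralScalar C X]
variable {Y : Type u} [NormedAddCommGroup Y] [NormedSpace ℂ Y] [Module C Y] [IsScalarTower ℂ C Y]
  [IsBoundedSMul C Y] [Module Cᵐᵒᵖ Y] [IsCentralScalar C Y]

theorem isRepresentable_gamma [TotallyDisconnectedSpace (characterSpace ℂ C)]
    (hX : IsRepresentable C X) (hY : IsRepresentable C Y) : IsRepresentable C (Gamma C X Y) := by
  let I : Type u := Σ t : characterSpace ℂ C,
    {F : X ⊗[C] Y →ₛₗ[(t : C →+* ℂ)] ℂ // ∀ v, ‖F v‖ ≤ gammaNorm (fiberMap t v)}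
  let f (i : I) : GammaPre C X Y →ₗ[ℂ] (ℂ →L[ℂ] ℂ) :=
    { toFun := fun w => algebraMap ℂ (ℂ →L[ℂ] ℂ) (i.2.1 w)
      map_add' := fun v w => by
        rw [← map_add]
        exact congrArg _ (map_add i.2.1 v w)
      map_smul' := fun z w =>
        (congrArg (algebraMap ℂ (ℂ →L[ℂ] ℂ)) (map_complex_smul i.2.1 z w)).trans <|
          (map_mul _ _ _).trans (Algebra.smul_def z _).symm }
  have hnorm (i : I) (w : GammaPre C X Y) : ‖f i w‖ = ‖i.2.1 w‖ :=
    norm_algebraMap' (ℂ →L[ℂ] ℂ) (i.2.1 w)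
  have hsmul (i : I) (c : C) (w : GammaPre C X Y) : f i (c • w) = characterRep i.1 c * f i w :=
    (congrArg (algebraMap ℂ (ℂ →L[ℂ] ℂ)) (map_smulₛₗ i.2.1 c w)).trans
      (map_mul (algebraMap ℂ (ℂ →L[ℂ] ℂ)) (i.1 c) (i.2.1 w))
  obtain ⟨J, hl, hr⟩ := exists_rep_completion_of_family (fun i : I => characterRep i.1) f
    (fun i w => (hnorm i w).trans_le ((i.2.2 w).trans (gammaNorm_fiberMap_le i.1 w)))
    (fun w b hb hw => gammaNorm_le_of_fiberMap_le hX hY hb fun t => by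
      obtain ⟨F, hF, hFw⟩ := exists_functional_eq_gammaNorm_fiberMap t w
      have := (hnorm ⟨t, F, hF⟩ w).symm.trans_le (hw ⟨t, F, hF⟩)
      rwa [hFw, Complex.norm_of_nonneg (gammaNorm_nonneg _)] at this)
    hsmul fun i c w => (hsmul i c w).trans (Algebra.commutes (i.1 c) (f i w))
  exact ⟨_, _, _, inferInstance, _, _, _, inferInstance, _, _, J, hl,
    fun c v => (congrArg J (op_smul_eq_smul c v)).trans (hr c v)⟩

theorem isNormalRepresentable_nu {H : Type u} [NormedAddCommGroup H] [InnerProductSpace ℂ H]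
    [CompleteSpace H] {ρ : C →⋆ₐ[ℂ] (H →L[ℂ] H)} (hρ : IsVonNeumann ρ)
    (hX : IsRepresentable C X) (hY : IsRepresentable C Y) :
    IsNormalRepresentable ρ (Nu ρ X Y) := by
  have := extremallyDisconnected_characterSpace hρ
  let I : Type u := {θ : X →ₗ[C] Y →ₗ[C] C // ∀ x y, ‖θ x y‖ ≤ ‖x‖ * ‖y‖}
  let f (i : I) : NuPre ρ X Y →ₗ[ℂ] (H →L[ℂ] H) :=
    ρ.toAlgHom.toLinearMap ∘ₗ (TensorProduct.lift i.1).restrictScalars ℂ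
  have hnorm (i : I) (w : NuPre ρ X Y) : ‖f i w‖ = ‖TensorProduct.lift i.1 w‖ :=
    NonUnitalStarAlgHom.norm_map ρ hρ.1 _
  have hsmul (i : I) (c : C) (w : NuPre ρ X Y) : f i (c • w) = ρ c * f i w :=
    (congrArg ρ (map_smul (TensorProduct.lift i.1) c w)).trans (map_mul ρ _ _)
  obtain ⟨J, hl, hr⟩ := exists_rep_completion_of_family (fun _ : I => ρ) f
    (fun i w => (hnorm i w).trans_le (norm_lift_le_nuNorm hρ.1 i.2 w))
    (fun w b _ hw => (nuNorm_eq_essNorm hρ hX hY w).trans_le <| essNorm_le_of_forall w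
      fun θ hθ => (hnorm ⟨θ, hθ⟩ w).symm.trans_le (hw ⟨θ, hθ⟩))
    hsmul fun i c w => (hsmul i c w).trans ((Commute.all c _).map ρ)
  exact ⟨_, _, _, inferInstance, _, _, _, inferInstance, _, _, J, isNormalRep_diagRep ρ,
    isNormalRep_diagRep ρ, hl, fun c v => (congrArg J (op_smul_eq_smul c v)).trans (hr c v)⟩

end TensorProducts

/-! ### The essential direct sum of the fibres -/

section EssSum

variable {Δ : Type u} [TopologicalSpace Δ] [BaireSpace Δ]
variable {E : Δ → Type u} [∀ t, NormedAddCommGroup (E t)]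

variable (E) in
/-- The quotient map onto the essential direct sum as a homomorphism of groups. -/
def essSumMkHom : lp E ∞ →+ EssSum E where
  toFun := EssSum.mk
  map_zero' := rfl
  map_add' _ _ := rfl

theorem norm_essSumMk_le (x : lp E ∞) : ‖EssSum.mk x‖ ≤ ‖x‖ :=
  essup_le (fun _ => norm_nonneg _) (norm_nonneg x)
    (.of_forall fun t => lp.norm_apply_le_norm ENNReal.top_ne_zero x t)

theorem essSumMk_eq_of_eventuallyEq {x y : lp E ∞} (h : ∀ᶠ t in residual Δ, x t = y t) :
    EssSum.mk x = EssSum.mk y := by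
  rw [← sub_eq_zero, ← norm_le_zero_iff]
  refine essup_le (fun _ => norm_nonneg _) le_rfl (h.mono fun t ht => ?_)
  exact (congrArg norm (sub_eq_zero.2 ht)).trans_le norm_zero.le

theorem exists_essSumMk_eq_norm_le (z : EssSum E) {r : ℝ} (hr : ‖z‖ < r) :
    ∃ x : lp E ∞, EssSum.mk x = z ∧ ‖x‖ ≤ r := by
  classical
  obtain ⟨x, rfl⟩ : ∃ x : lp E ∞, EssSum.mk x = z := SeparationQuotient.surjective_mk z
  have hr0 : 0 ≤ r := (norm_nonneg _).trans hr.le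
  have hle (t : Δ) : ‖if ‖x t‖ < r then x t else 0‖ ≤ r := by
    split_ifs with ht
    · exact ht.le
    · rwa [norm_zero]
  let y : lp E ∞ := ⟨fun t => if ‖x t‖ < r then x t else 0, memℓp_infty ⟨r, forall_mem_range.2 hle⟩⟩
  refine ⟨y, essSumMk_eq_of_eventuallyEq ?_, lp.norm_le_of_forall_le hr0 hle⟩
  exact (eventually_lt_of_essup_lt (lp.memℓp x).bddAbove hr).mono fun t ht => if_pos ht

instance [∀ t, CompleteSpace (E t)] : CompleteSpace (EssSum E) := by
  refine NormedAddCommGroup.completeSpace_of_summable_imp_tendsto fun u hu => ?_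
  choose x hxu hx using fun n => exists_essSumMk_eq_norm_le (u n)
    (lt_add_of_pos_right ‖u n‖ (by positivity : (0 : ℝ) < (1 / 2) ^ n))
  have hsum : Summable x := .of_norm_bounded (hu.add summable_geometric_two) hx
  have hcont : Continuous (essSumMkHom E) :=
    AddMonoidHomClass.continuous_of_bound _ 1 fun x =>
      (norm_essSumMk_le x).trans_eq (one_mul _).symm
  refine ⟨essSumMkHom E (∑' n, x n), ?_⟩
  refine ((hcont.tendsto _).comp hsum.hasSum.tendsto_sum_nat).congr fun n => ?_
  rw [Function.comp_apply, map_sum]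
  exact Finset.sum_congr rfl fun i _ => hxu i

end EssSum

section ToGamma

variable {R : Type*} [SeminormedCommRing R] {X Y : Type u} [NormedAddCommGroup X] [Module R X]
  [IsBoundedSMul R X] [NormedAddCommGroup Y] [Module R Y]

variable (R X Y) in
/-- The canonical map from the algebraic to the projective tensor product. -/
def toGamma : X ⊗[R] Y →ₗ[R] Gamma R X Y where
  toFun w := ((show GammaPre R X Y from w : GammaPre R X Y) : Completion (GammaPre R X Y))
  map_add' v w := Completion.coe_add (α := GammaPre R X Y) v w
  map_smul' c w := Completion.coe_smul (X := GammaPre R X Y) c w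

theorem norm_toGamma (w : X ⊗[R] Y) : ‖toGamma R X Y w‖ = gammaNorm w :=
  Completion.norm_coe (E := GammaPre R X Y) w

theorem denseRange_toGamma : DenseRange (toGamma R X Y) :=
  Completion.denseRange_coe (α := GammaPre R X Y)

end ToGamma

section FiberFamily

variable {C : Type u} [CommCStarAlgebra C]
variable {X : Type u} [NormedAddCommGroup X] [NormedSpace ℂ X] [Module C X] [IsScalarTower ℂ C X]
variable {Y : Type u} [NormedAddCommGroup Y] [NormedSpace ℂ Y] [Module C Y] [IsScalarTower ℂ C Y]

variable (C X Y) in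
/-- The family of all fibres of a tensor over `C`. -/
def fiberFamily : X ⊗[C] Y →ₗ[ℂ]
    lp (fun t : characterSpace ℂ C => Gamma ℂ (Fiber t X) (Fiber t Y)) ∞ where
  toFun w := ⟨fun t => toGamma ℂ _ _ (fiberMap t w),
    memℓp_infty ⟨gammaNorm w, forall_mem_range.2 fun t =>
      (norm_toGamma (fiberMap t w)).trans_le (gammaNorm_fiberMap_le t w)⟩⟩
  map_add' v w := lp.ext <| funext fun t =>
    (congrArg (toGamma ℂ _ _) (map_add (fiberMap t) v w)).trans (map_add _ _ _)
  map_smul' z w := lp.ext <| funext fun t => by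
    change toGamma ℂ _ _ (fiberMap t (z • w)) = z • toGamma ℂ _ _ (fiberMap t w)
    rw [← algebraMap_smul C z w, fiberMap_smul, AlgHomClass.commutes, map_smul]
    rfl

theorem fiberFamily_tmul (x : X) (y : Y) : fiberFamily C X Y (x ⊗ₜ y) = fiberTensor x y := rfl

theorem norm_essSumMk_fiberFamily (w : X ⊗[C] Y) :
    ‖EssSum.mk (fiberFamily C X Y w)‖ = essNorm w :=
  congrArg essup (funext fun t => norm_toGamma (fiberMap t w))

end FiberFamily

/-! ### The normal part of the projective tensor product -/

section Density

variable {C : Type u} [CommCStarAlgebra C]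
variable {W : Type u} [NormedAddCommGroup W] [NormedSpace ℂ W] [Module C W] [Module Cᵐᵒᵖ W]

theorem IsRepresentable.continuous_op_smul (h : IsRepresentable C W) (c : C) :
    Continuous fun v : W => op c • v := by
  obtain ⟨K, _, _, _, L, _, _, _, π, σ, J, -, hr⟩ := h
  refine J.isometry.isUniformInducing.isInducing.continuous_iff.2 ?_
  exact (((ContinuousLinearMap.compL ℂ L L K).flip (σ c)).continuous.comp J.continuous).congr
    fun v => (hr c v).symm

theorem isBimoduleMap_of_denseRange {V : Type u} [NormedAddCommGroup V] [NormedSpace ℂ V]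
    [Module C V] [ContinuousConstSMul C V] [Module Cᵐᵒᵖ V] [IsCentralScalar C V]
    (hW : IsRepresentable C W) (T : V →L[ℂ] W) {M : Type*} {j : M → V} (hj : DenseRange j)
    (hT : ∀ (c : C) (m : M), T (c • j m) = c • T (j m) ∧ T (c • j m) = op c • T (j m)) :
    IsBimoduleMap C T := by
  have := hW.isBoundedSMul
  have hsmul (c : C) : Continuous fun v => T (c • v) := T.continuous.comp (continuous_const_smul c)
  refine fun c v => ⟨?_, (congrArg T (op_smul_eq_smul c v)).trans ?_⟩
  · exact hj.induction_on v (isClosed_eq (hsmul c) (by fun_prop)) fun m => (hT c m).1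
  · exact hj.induction_on v (isClosed_eq (hsmul c)
      ((hW.continuous_op_smul c).comp T.continuous)) fun m => (hT c m).2

end Density

section NormalPart

variable {C : Type u} [CommCStarAlgebra C]
variable {H : Type u} [NormedAddCommGroup H] [InnerProductSpace ℂ H] [CompleteSpace H]
variable {ρ : C →⋆ₐ[ℂ] (H →L[ℂ] H)}
variable {X : Type u} [NormedAddCommGroup X] [NormedSpace ℂ X] [Module C X] [IsScalarTower ℂ C X]
  [Module Cᵐᵒᵖ X]
variable {Y : Type u} [NormedAddCommGroup Y] [NormedSpace ℂ Y] [Module C Y] [IsScalarTower ℂ C Y]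
  [Module Cᵐᵒᵖ Y]

theorem nuNorm_le_gammaNorm (w : X ⊗[C] Y) : nuNorm ρ w ≤ gammaNorm w :=
  Real.sSup_le (fun _ => nuSet_le ρ) (gammaNorm_nonneg w)

variable (ρ X Y) in
/-- The canonical map from the algebraic to the normal projective tensor product. -/
def toNu : X ⊗[C] Y →ₗ[C] Nu ρ X Y where
  toFun w := ((show NuPre ρ X Y from w : NuPre ρ X Y) : Completion (NuPre ρ X Y))
  map_add' v w := Completion.coe_add (α := NuPre ρ X Y) v w
  map_smul' c w := Completion.coe_smul (X := NuPre ρ X Y) c w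

theorem norm_toNu (w : X ⊗[C] Y) : ‖toNu ρ X Y w‖ = nuNorm ρ w :=
  Completion.norm_coe (E := NuPre ρ X Y) w

theorem denseRange_toNu : DenseRange (toNu ρ X Y) :=
  Completion.denseRange_coe (α := NuPre ρ X Y)

variable [IsBoundedSMul C X]

variable (ρ X Y) in
theorem exists_gamma_to_nu : ∃ ι : Gamma C X Y →L[ℂ] Nu ρ X Y,
    (∀ w, ι (toGamma C X Y w) = toNu ρ X Y w) ∧ ‖ι‖ ≤ 1 :=
  exists_extension_completion (V := GammaPre C X Y) ((toNu ρ X Y).restrictScalars ℂ) zero_le_one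
    fun w => (norm_toNu w).trans_le ((nuNorm_le_gammaNorm w).trans_eq (one_mul _).symm)

variable [IsCentralScalar C X] [IsCentralScalar C Y]

theorem exists_extension_nu {V : Type u} [NormedAddCommGroup V] [NormedSpace ℂ V] [CompleteSpace V]
    [Module C V] [Module Cᵐᵒᵖ V] (hV : IsNormalRepresentable ρ V) {T : Gamma C X Y →L[ℂ] V}
    (hT : IsBimoduleMap C T) :
    ∃ T' : Nu ρ X Y →L[ℂ] V, (∀ w, T' (toNu ρ X Y w) = T (toGamma C X Y w)) ∧ ‖T'‖ ≤ ‖T‖ := by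
  have := hV.isRepresentable.isScalarTower
  let f : X ⊗[C] Y →ₗ[C] V :=
    { toFun := fun w => T (toGamma C X Y w)
      map_add' := fun v w => by rw [map_add, map_add]
      map_smul' := fun c w => by rw [map_smul, (hT c _).1, RingHom.id_apply] }
  have hf_op (c : C) (x : X) (y : Y) : f (x ⊗ₜ (op c • y)) = op c • f (x ⊗ₜ y) :=
    calc T (toGamma C X Y (x ⊗ₜ (op c • y))) = T (op c • toGamma C X Y (x ⊗ₜ y)) := by
          rw [op_smul_eq_smul, TensorProduct.tmul_smul, map_smul, op_smul_eq_smul]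
      _ = op c • T (toGamma C X Y (x ⊗ₜ y)) := (hT c _).2
  have hf_norm (x : X) (y : Y) : ‖f (x ⊗ₜ y)‖ ≤ ‖T‖ * (‖x‖ * ‖y‖) :=
    (T.le_opNorm _).trans <| mul_le_mul_of_nonneg_left
      ((norm_toGamma _).trans_le (gammaNorm_tmul_le x y)) (norm_nonneg T)
  refine exists_extension_completion (V := NuPre ρ X Y) (f.restrictScalars ℂ) (norm_nonneg T)
    fun w => ?_
  have h := norm_lift_le_mul_nuNorm hV (φ := (TensorProduct.mk C X Y).compr₂ f) hf_op
    (norm_nonneg T) hf_norm w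
  rwa [TensorProduct.lift_mk_compr₂] at h

variable [IsBoundedSMul C Y]

theorem isNormalPart_of_apply (hρ : IsVonNeumann ρ) (hX : IsRepresentable C X)
    (hY : IsRepresentable C Y) {ι : Gamma C X Y →L[ℂ] Nu ρ X Y}
    (hι : ∀ w, ι (toGamma C X Y w) = toNu ρ X Y w) (hι_norm : ‖ι‖ ≤ 1) : IsNormalPart ρ ι := by
  have := extremallyDisconnected_characterSpace hρ
  have hNu := isNormalRepresentable_nu hρ hX hY
  refine ⟨inferInstance, isRepresentable_gamma hX hY, inferInstance, hNu, hι_norm, ?_, ?_⟩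
  · refine isBimoduleMap_of_denseRange hNu.isRepresentable ι denseRange_toGamma fun c w => ?_
    rw [op_smul_eq_smul, ← map_smul, hι, hι, map_smul, and_self]
  intro V _ _ _ _ _ hV T hT
  obtain ⟨T', hT', hT'_norm⟩ := exists_extension_nu hV hT
  refine ⟨T', ?_, ?_, hT'_norm, fun S _ hS => ?_⟩
  · refine isBimoduleMap_of_denseRange hV.isRepresentable T' denseRange_toNu fun c w => ?_
    rw [← map_smul, hT', hT', map_smul, ← (hT c _).1, ← (hT c _).2, op_smul_eq_smul, and_self]
  · exact DFunLike.coe_injective <| denseRange_toGamma.equalizer (T'.comp ι).continuous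
      T.continuous <| funext fun w => (congrArg T' (hι w)).trans (hT' w)
  · refine DFunLike.coe_injective <| denseRange_toNu.equalizer S.continuous T'.continuous <|
      funext fun w => ?_
    rw [Function.comp_apply, Function.comp_apply, hT', ← hι, ← hS, ContinuousLinearMap.comp_apply]

theorem exists_isometry_essSum (hρ : IsVonNeumann ρ) (hX : IsRepresentable C X)
    (hY : IsRepresentable C Y) :
    ∃ κ : Nu ρ X Y →ₗᵢ[ℂ]
        EssSum fun t : characterSpace ℂ C => Gamma ℂ (Fiber t X) (Fiber t Y),
      ∀ w, κ (toNu ρ X Y w) = EssSum.mk (fiberFamily C X Y w) := by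
  let κ : NuPre ρ X Y →ₗᵢ[ℂ]
      EssSum fun t : characterSpace ℂ C => Gamma ℂ (Fiber t X) (Fiber t Y) :=
    { toFun := fun w => EssSum.mk (fiberFamily C X Y w)
      map_add' := fun v w => congrArg EssSum.mk (map_add (fiberFamily C X Y) v w)
      map_smul' := fun z w => congrArg EssSum.mk (map_smul (fiberFamily C X Y) z w)
      norm_map' := fun w =>
        (norm_essSumMk_fiberFamily w).trans (nuNorm_eq_essNorm hρ hX hY w).symm }
  exact exists_isometry_completion κ

end NormalPart

end CentralModule

end

theorem mainTheorem7_general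
    {C : Type u} [CommCStarAlgebra C]
    {H : Type u} [NormedAddCommGroup H] [InnerProductSpace ℂ H] [CompleteSpace H]
    (ρ : C →⋆ₐ[ℂ] (H →L[ℂ] H)) (hρ : IsVonNeumann ρ)
    {X : Type u} [NormedAddCommGroup X] [NormedSpace ℂ X]
    [Module C X] [IsScalarTower ℂ C X] [IsBoundedSMul C X]
    [Module Cᵐᵒᵖ X] [IsCentralScalar C X] (hX : IsRepresentable C X)
    {Y : Type u} [NormedAddCommGroup Y] [NormedSpace ℂ Y]
    [Module C Y] [IsScalarTower ℂ C Y] [IsBoundedSMul C Y]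
    [Module Cᵐᵒᵖ Y] [IsCentralScalar C Y] (hY : IsRepresentable C Y) :
    ((∃ ι : Gamma C X Y →L[ℂ] Nu ρ X Y,
        (∀ x y, ι (Gamma.tmul C x y) = Nu.tmul ρ x y) ∧ IsNormalPart ρ ι) ∧
      ∃ κ : Nu ρ X Y →ₗᵢ[ℂ]
          EssSum fun t : WeakDual.characterSpace ℂ C => Gamma ℂ (Fiber t X) (Fiber t Y),
        ∀ x y, κ (Nu.tmul ρ x y) = EssSum.mk (fiberTensor x y)) ∧
    (∀ (n : ℕ) (x : Fin n → X) (y : Fin n → Y),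
      IsLUB {r : ℝ | ∃ θ : X →ₗ[C] Y →ₗ[C] C, (∀ a b, ‖θ a b‖ ≤ ‖a‖ * ‖b‖) ∧
          r = ‖∑ j, θ (x j) (y j)‖}
        (nuNorm ρ (∑ j, x j ⊗ₜ[C] y j))) ∧
    (∀ (n : ℕ) (x : Fin n → X) (y : Fin n → Y),
      IsLUB {r : ℝ | ∃ θ : X →ₗ[ℂ] Y →ₗ[ℂ] ℂ, (∀ a b, ‖θ a b‖ ≤ ‖a‖ * ‖b‖) ∧
          (∀ (c : C) a b, θ (op c • a) b = θ a (c • b)) ∧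
          (∀ a b, Continuous[weakStar ρ, inferInstance] fun c : C => θ a (c • b)) ∧
          r = ‖∑ j, θ (x j) (y j)‖}
        (nuNorm ρ (∑ j, x j ⊗ₜ[C] y j))) := by
  obtain ⟨ι, hι, hι_norm⟩ := exists_gamma_to_nu ρ X Y
  obtain ⟨κ, hκ⟩ := exists_isometry_essSum hρ hX hY
  exact ⟨⟨⟨ι, fun x y => hι (x ⊗ₜ y), isNormalPart_of_apply hρ hX hY hι hι_norm⟩,
    κ, fun x y => (hκ _).trans (congrArg EssSum.mk (fiberFamily_tmul x y))⟩,
    fun _ => isLUB_nuNorm_module hρ hX hY, fun _ => isLUB_nuNorm_normal hρ hX hY⟩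

theorem mainTheorem7
    {C : Type u} [CommCStarAlgebra C]
    {H : Type u} [NormedAddCommGroup H] [InnerProductSpace ℂ H] [CompleteSpace H]
    (ρ : C →⋆ₐ[ℂ] (H →L[ℂ] H)) (hρ : IsVonNeumann ρ)
    {X : Type u} [NormedAddCommGroup X] [NormedSpace ℂ X] [CompleteSpace X]
    [Module C X] [IsScalarTower ℂ C X] [IsBoundedSMul C X]
    [Module Cᵐᵒᵖ X] [IsCentralScalar C X] (hX : IsNormalRepresentable ρ X)
    {Y : Type u} [NormedAddCommGroup Y] [NormedSpace ℂ Y] [CompleteSpace Y]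
    [Module C Y] [IsScalarTower ℂ C Y] [IsBoundedSMul C Y]
    [Module Cᵐᵒᵖ Y] [IsCentralScalar C Y] (hY : IsNormalRepresentable ρ Y) :
    ((∃ ι : Gamma C X Y →L[ℂ] Nu ρ X Y,
        (∀ x y, ι (Gamma.tmul C x y) = Nu.tmul ρ x y) ∧ IsNormalPart ρ ι) ∧
      ∃ κ : Nu ρ X Y →ₗᵢ[ℂ]
          EssSum fun t : WeakDual.characterSpace ℂ C => Gamma ℂ (Fiber t X) (Fiber t Y),
        ∀ x y, κ (Nu.tmul ρ x y) = EssSum.mk (fiberTensor x y)) ∧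
    (∀ (n : ℕ) (x : Fin n → X) (y : Fin n → Y),
      IsLUB {r : ℝ | ∃ θ : X →ₗ[C] Y →ₗ[C] C, (∀ a b, ‖θ a b‖ ≤ ‖a‖ * ‖b‖) ∧
          r = ‖∑ j, θ (x j) (y j)‖}
        (nuNorm ρ (∑ j, x j ⊗ₜ[C] y j))) ∧
    (∀ (n : ℕ) (x : Fin n → X) (y : Fin n → Y),
      IsLUB {r : ℝ | ∃ θ : X →ₗ[ℂ] Y →ₗ[ℂ] ℂ, (∀ a b, ‖θ a b‖ ≤ ‖a‖ * ‖b‖) ∧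
          (∀ (c : C) a b, θ (op c • a) b = θ a (c • b)) ∧
          (∀ a b, Continuous[weakStar ρ, inferInstance] fun c : C => θ a (c • b)) ∧
          r = ‖∑ j, θ (x j) (y j)‖}
        (nuNorm ρ (∑ j, x j ⊗ₜ[C] y j))) :=
  mainTheorem7_general ρ hρ hX.isRepresentable hY.isRepresentable
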